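/- **Setting.** Let $G=(V,E)$ be a finite connected undirected unweighted graph with degree vector $\mathbf d$ and $\mathrm{vol}(G)=\sum_v\deg(v)$. Let $\Delta:V\to\mathbb R_{\ge 0}$ be a source mass with total mass $|\Delta|=\sum_v\Delta(v)<\mathrm{vol}(G)$, such that $\Delta(v)>\deg(v)$ for at least one $v$ and $\Delta$ is supported on at most $|\Delta|$ nodes (for example $\Delta=\delta\cdot\deg$ on a nonempty seed set and $0$ elsewhere, with $\delta>1$ and $|\Delta|<\mathrm{vol}(G)$). Let $1/p+1/q=1$ with $q\in(1,2]$. The regularized dual problem is $$\min_{x\ge 0}\ F(x)=\tfrac1q\sum_{(i,j)\in E}|x(i)-x(j)|^q-x^T(\Delta-\mathbf d),$$ and for $\mu>0$ its smoothed objective is $$F_\mu(x)=\tfrac1q\sum_{(i,j)\in E}\big((x(i)-x(j))^2+\mu^2\big)^{q/2}-x^T(\Delta-\mathbf d).$$ Let $x_\mu^*$ be the minimizer of $F_\mu$ over $x\ge 0$, let $\bar d=\max_{i\in\mathrm{supp}(x_\mu^*)}\deg(i)$, and let $\gamma>0$ be any strong convexity parameter of $F_\mu$ on $$U=\{x:\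 \mathrm{supp}(x)\subseteq\mathrm{supp}(x^*_\mu),\ (x(i)-x(j))^2+\mu^2\le|\Delta|^{2p-2}\ \ \forall (i,j)\in E\},$$ that is, $F_\mu(y)\ge F_\mu(x)+\nabla F_\mu(x)^T(y-x)+\frac\gamma2\|y-x\|_2^2$ for all $x,y\in U$. **Algorithm.** Start at $x_0=0$. In iteration $k$ let $S_k=\{i:\nabla_iF_\mu(x_k)<0\}$; if $S_k=\emptyset$, return $x_k$; otherwise pick $i_k\in S_k$ uniformly at random and set $x_{k+1}=x_k-\frac{\mu^{2-q}}{\deg(i_k)}\nabla_{i_k}F_\mu(x_k)\,e_{i_k}$. The algorithm is implemented by a program that stores heights, net inflows and the set of active nodes, and updates in each iteration only $i_k$ and its neighbors. Running time is the number of its elementary operations, initialization included, in the following model: one unit for each arithmetic operation (powers included) or comparison of real numbers, each access to an array cell or to a list entry, each reading of $\Delta(v)$ or $\deg(v)$, and each insertion, deletion, emptiness test or uniform sampling on a set of nodes; the graph is given by adjacency lists, $\Delta$ by the list of its support, and arrays are sparse with default value $0$. **Claim.** There is a constant $c_0>0$ such that for every $c\in(0,c_0]$ there is a constant $C>0$,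 depending only on $c$, with the following property. For all $p,q$ as above and every $M$ there is $\varepsilon_0>0$, depending only on $c$, $p$ and $M$, such that for all $G$ and $\Delta$ as above with $|\Delta|=M$, every $0<\varepsilon\le\varepsilon_0$ and every $\mu$ with $c\,(\varepsilon/|\Delta|)^{1/q}\le\mu\le c_0\,(\varepsilon/|\Delta|)^{1/q}$: 1. For every $k$, the program's iterate after $k$ iterations has the law of $x_k$. 2. $\bar d\le|\Delta|$, and there is a strong convexity parameter $\gamma$ of $F_\mu$ on $U$ with $\gamma>\frac{1}{(p-1)|\Delta|^p}$. 3. For every $\gamma$ as above there is $K$ such that $\mathbb E[F(x_K)]\le F(y)+\varepsilon$ for all $y\ge 0$ (so $x_K$ is $\varepsilon$-accurate in expectation), and for every outcome of the random choices the total running time of the first $K$ iterations is at most $$C\cdot\frac{|\Delta|\,\bar d^{\,2}}{\gamma}\Big(\frac{|\Delta|}{\varepsilon}\Big)^{2/q-1}\log\frac1\varepsilon .$$ In particular, by 2, with a suitable choice of $\gamma$ the running time is bounded in terms of $p$, $|\Delta|$, $\varepsilon$ and $c$ alone, independently of the size of the graph: the algorithm is strongly local. -/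

import Mathlib

open Finset

noncomputable section

namespace FlowDiffusion

section Problem

variable {V : Type} [Fintype V] [DecidableEq V] (G : SimpleGraph V) [DecidableRel G.Adj]
  (q μ : ℝ) (Δ : V → ℝ)

/-- Total source mass `|Δ| = ∑ v, Δ(v)`. -/
def mass : ℝ := ∑ v, Δ v

/-- Volume of the whole graph, `vol(G) = ∑ v, deg(v)`. -/
def volume : ℝ := ∑ v, (G.degree v : ℝ)

/-- The support of a vector indexed by the nodes. -/
def supp (x : V → ℝ) : Finset V := {v | x v ≠ 0}

/-- `∑_{(i,j) ∈ E} φ(x(i) - x(j))` for an even function `φ`. The double sum visits every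
undirected edge twice, once in each direction, whence the factor `1/2`. -/
def edgeSum (φ : ℝ → ℝ) (x : V → ℝ) : ℝ :=
  (1 / 2) * ∑ i, ∑ j ∈ G.neighborFinset i, φ (x i - x j)

/-- The linear term `xᵀ(Δ - d)`, where `d` is the degree vector. -/
def linTerm (x : V → ℝ) : ℝ := ∑ i, x i * (Δ i - G.degree i)

/-- Objective of the regularized dual problem: `F(x) = (1/q) ‖Bx‖_q^q - xᵀ(Δ - d)`. -/
def F (x : V → ℝ) : ℝ := (1 / q) * edgeSum G (fun t => |t| ^ q) x - linTerm G Δ x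

/-- Objective of the globally smoothed problem:
`F_μ(x) = (1/q) ∑_{(i,j) ∈ E} ((x(i) - x(j))² + μ²)^{q/2} - xᵀ(Δ - d)`. -/
def Fmu (x : V → ℝ) : ℝ :=
  (1 / q) * edgeSum G (fun t => (t ^ 2 + μ ^ 2) ^ (q / 2)) x - linTerm G Δ x

/-- The `i`-th entry of the gradient of `H` at `x`. -/
def partialDeriv (H : (V → ℝ) → ℝ) (i : V) (x : V → ℝ) : ℝ :=
  deriv (fun t => H (Function.update x i t)) (x i)

/-- `xs` is an optimal solution of `min_{x ≥ 0} F_μ(x)`. -/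
def IsSmoothedOptimum (xs : V → ℝ) : Prop :=
  0 ≤ xs ∧ ∀ y : V → ℝ, 0 ≤ y → Fmu G q μ Δ xs ≤ Fmu G q μ Δ y

/-- `d̄`, the largest degree of a node in the support of `xs`. -/
def maxDegree (xs : V → ℝ) : ℕ := (supp xs).sup fun v => G.degree v

/-- The set `U(xs)` of all `x` with `supp(x) ⊆ supp(xs)` and
`(x(i) - x(j))² + μ² ≤ |Δ|^{2p-2}` on every edge `(i,j)`. -/
def region (p : ℝ) (xs : V → ℝ) : Set (V → ℝ) :=
  {x | supp x ⊆ supp xs ∧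
    ∀ i j, G.Adj i j → (x i - x j) ^ 2 + μ ^ 2 ≤ mass Δ ^ (2 * p - 2)}

/-- `F_μ` is strongly convex on `U(xs)` with parameter `γ`. -/
def StronglyConvex (p : ℝ) (xs : V → ℝ) (γ : ℝ) : Prop :=
  ∀ x ∈ region G μ Δ p xs, ∀ y ∈ region G μ Δ p xs,
    Fmu G q μ Δ x + ∑ i, partialDeriv (Fmu G q μ Δ) i x * (y i - x i)
        + γ / 2 * ∑ i, (y i - x i) ^ 2
      ≤ Fmu G q μ Δ y

/-! ### The coordinate method -/

/-- `S(x) = {i | ∇_i F_μ(x) < 0}`. -/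
def negSet (x : V → ℝ) : Finset V := {i | partialDeriv (Fmu G q μ Δ) i x < 0}

/-- The coordinate update `x - (μ^{2-q} / deg(i)) ∇_i F_μ(x) e_i`. -/
def coordStep (x : V → ℝ) (i : V) : V → ℝ :=
  Function.update x i (x i - μ ^ (2 - q) / G.degree i * partialDeriv (Fmu G q μ Δ) i x)

/-- The law of the `k`-th iterate `x_k` of the coordinate method: start at `x_0 = 0`, in each
iteration pick `i_k` uniformly at random in `S(x_k)` and update this coordinate; once `S(x_k)`
is empty, `x_k` is returned and no longer changes. -/
def iterate : ℕ → PMF (V → ℝ)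
  | 0 => PMF.pure 0
  | k + 1 => (iterate k).bind fun x =>
      if h : (negSet G q μ Δ x).Nonempty then
        (PMF.uniformOfFinset (negSet G q μ Δ x) h).map (coordStep G q μ Δ x)
      else PMF.pure x

/-- Expectation of `f` under a discrete law. (All laws in use here have finite support.) -/
def expect {α : Type} (P : PMF α) (f : α → ℝ) : ℝ := ∑' a, (P a).toReal * f a

end Problem

/-! ### Step counting

A computation is a value together with the number of elementary operations that were spent on
it. The cost model is a real-number random access machine: one unit for each arithmetic
operation (power included) or comparison of real numbers, each reading or writing of an array
cell, each reading of `Δ(v)`, `deg(v)` or an entry of a list of nodes, and each insertion, deletion, emptiness test or uniform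
sampling on a set of nodes (kept as an array together with a table of positions).
The graph is given by adjacency lists, the source mass by the list of its support. Arrays indexed by nodes are sparse with default entry 0;
they are never initialized or scanned as a whole. -/

/-- A value and the number of elementary operations spent on it. -/
structure Timed (α : Type) where
  val : α
  time : ℕ

namespace Timed

instance : Monad Timed where
  pure a := ⟨a, 0⟩
  bind m f := ⟨(f m.val).val, m.time + (f m.val).time⟩

/-- One elementary operation with result `a`. -/
def tick {α : Type} (a : α) : Timed α := ⟨a, 1⟩

end Timed

open Timed

/-- Memory of the program: the heights `x(v)`, the net mass `inflow(v)` that has been routed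
into `v` so far, and the set of active nodes. -/
structure Memory (V : Type) where
  height : V → ℝ
  inflow : V → ℝ
  active : Finset V

section Program

variable {V : Type} [Fintype V] [DecidableEq V] (G : SimpleGraph V) [DecidableRel G.Adj]
  (q μ : ℝ) (Δ : V → ℝ)

/-- Compute the flow `((a - b)² + μ²)^{q/2-1} (a - b)` between two nodes of heights `a, b`. -/
def computeFlow (a b : ℝ) : Timed ℝ := do
  let d ← tick (a - b)
  let d2 ← tick (d * d)
  let m2 ← tick (μ * μ)
  let s ← tick (d2 + m2)
  let h ← tick (q / 2)
  let e ← tick (h - 1)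
  let w ← tick (s ^ e)
  tick (w * d)

/-- Compute the current mass `Δ(v) + inflow(v)` of the node `v`. -/
def computeMass (v : V) (s : Memory V) : Timed ℝ := do
  let a ← tick (Δ v)
  let b ← tick (s.inflow v)
  tick (a + b)

/-- Test whether the mass of `v` exceeds `deg(v)` and update the set of active nodes. -/
def refresh (v : V) (s : Memory V) : Timed (Memory V) := do
  let m ← computeMass Δ v s
  let d ← tick (G.degree v : ℝ)
  let b ← tick (decide (d < m))
  if b then tick { s with active := insert v s.active }
  else tick { s with active := s.active.erase v }

/-- The height of `i` has changed from `a` to `b`: update the flow from `i` to its neighbor `j`,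
and the activity of `j`. -/
def updateEdge (i : V) (a b : ℝ) (s : Memory V) (j : V) : Timed (Memory V) := do
  let j ← tick j
  let c ← tick (s.height j)
  let old ← computeFlow q μ a c
  let new ← computeFlow q μ b c
  let t ← tick (new - old)
  let u ← tick (s.inflow j)
  let u' ← tick (u + t)
  let s ← tick { s with inflow := Function.update s.inflow j u' }
  let w ← tick (s.inflow i)
  let w' ← tick (w - t)
  let s ← tick { s with inflow := Function.update s.inflow i w' }
  refresh G Δ j s

/-- The body of the loop, after the node `i` has been picked: raise the height of `i`, then walk
through the adjacency list of `i`. -/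
def push (i : V) (s : Memory V) : Timed (Memory V) := do
  let m ← computeMass Δ i s
  let d ← tick (G.degree i : ℝ)
  let g ← tick (d - m)
  let e ← tick (2 - q)
  let r ← tick (μ ^ e)
  let r' ← tick (r / d)
  let t ← tick (r' * g)
  let a ← tick (s.height i)
  let b ← tick (a - t)
  let s ← tick { s with height := Function.update s.height i b }
  let s ← (G.neighborFinset i).toList.foldlM (updateEdge G q μ Δ i a b) s
  refresh G Δ i s

/-- Initialization: all heights and flows are zero; every node with source mass is inspected. -/
def start : Timed (Memory V) := do
  let s ← tick { height := 0, inflow := 0, active := ∅ }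
  let s ← (supp Δ).toList.foldlM (fun s v => do
    let v ← tick v
    refresh G Δ v s) s
  -- test whether there is an active node
  tick s

/-- One iteration: if there is an active node, sample one of them uniformly (one unit), execute
the loop body, and test whether there are active nodes left (one unit). Otherwise the program has
stopped. -/
def iteration (r : Timed (Memory V)) : PMF (Timed (Memory V)) :=
  if h : r.val.active.Nonempty then
    (PMF.uniformOfFinset r.val.active h).map fun i => do
      let s ← r
      let i ← tick i
      let s ← push G q μ Δ i s
      tick s
  else PMF.pure r

/-- The law of the memory and of the total time (initialization included) after at most `k`
iterations of the program. -/
def run : ℕ → PMF (Timed (Memory V))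
  | 0 => PMF.pure (start G Δ)
  | k + 1 => (run k).bind (iteration G q μ Δ)

end Program

end FlowDiffusion

end

open FlowDiffusion

set_option linter.unusedSectionVars false

namespace FlowDiffusion

/-! The partial derivative of `Fmu` at a node is its degree minus its current mass, that is, source
plus net inflow of `flow`. Three facts carry the proof.

Locality: flow across the boundary of an upper level set of the heights only leaves it. If the
gradient is nonpositive on the set, its volume plus the flow on any one crossing edge is at most
`|Δ|` (`volume_add_flow_le_mass`). This bounds the volume of the support of the optimum, and also
every edge flow, hence every height difference, along the iteration.

Monotonicity: the step is the inverse of the coordinate smoothness, so the partial derivative of the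
raised node stays nonpositive, while those of all other nodes can only drop. Comparison with the
optimum shows that the iterates never exceed it (`below_step`). They therefore stay in `region`, and
only nodes of the optimal support are ever raised.

Convergence: on `region` every edge term has curvature bounded below, and a Poincaré inequality
along shortest paths turns this into strong convexity (`exists_stronglyConvex`). Since the optimum
dominates the iterate, only negative partial derivatives matter in the resulting gradient inequality
(`gap_le`), so a uniform choice among them contracts the expected gap by `1 - γ μ^(2-q) / (|Δ| d̄)`
(`sum_gap_step_le`). Order `(|Δ| d̄ μ^(q-2) / γ) log (1/ε)` iterations make the gap at most `ε/2`;
passing back to `F` costs at most `μ^q |Δ| ≤ ε/2` (`objective_le`). Each iteration costs `O(d̄)`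
operations on every outcome (`Instance.run_time_le`). -/

/-- The flow between two nodes whose heights differ by `t`. -/
noncomputable def flow (q μ t : ℝ) : ℝ := (t ^ 2 + μ ^ 2) ^ (q / 2 - 1) * t

/-- A function whose derivative grows at least at rate `m` lies above its tangent parabolas. -/
theorem quadratic_lower_bound {D : Set ℝ} (hD : Convex ℝ D) {g f : ℝ → ℝ} {m : ℝ}
    (hg : ∀ u ∈ D, HasDerivAt g (f u) u)
    (hf : ∀ u ∈ D, ∀ v ∈ D, u ≤ v → m * (v - u) ≤ f v - f u)
    {s t : ℝ} (hs : s ∈ D) (ht : t ∈ D) :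
    g t + f t * (s - t) + m / 2 * (s - t) ^ 2 ≤ g s := by
  have hder : ∀ u ∈ D, HasDerivAt (fun u => g u - m / 2 * (u - t) ^ 2) (f u - m * (u - t)) u := by
    intro u hu
    have h := (((hasDerivAt_id u).sub_const t).pow 2).const_mul (m / 2)
    refine ((hg u hu).sub h).congr_deriv ?_
    simp
    ring
  rcases lt_trichotomy s t with h | h | h
  · have hsub : Set.Icc s t ⊆ D := hD.ordConnected.out hs ht
    obtain ⟨c, hc, he⟩ := exists_hasDerivAt_eq_slope _ _ h
      (fun u hu => (hder u (hsub hu)).continuousAt.continuousWithinAt)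
      (fun u hu => hder u (hsub (Set.Ioo_subset_Icc_self hu)))
    have h1 := hf c (hsub (Set.Ioo_subset_Icc_self hc)) t ht hc.2.le
    rw [eq_div_iff (by linarith)] at he
    have h2 : (f c - m * (c - t)) * (t - s) ≤ f t * (t - s) :=
      mul_le_mul_of_nonneg_right (by linarith) (by linarith)
    simp at he
    linarith
  · simp [h]
  · have hsub : Set.Icc t s ⊆ D := hD.ordConnected.out ht hs
    obtain ⟨c, hc, he⟩ := exists_hasDerivAt_eq_slope _ _ h
      (fun u hu => (hder u (hsub hu)).continuousAt.continuousWithinAt)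
      (fun u hu => hder u (hsub (Set.Ioo_subset_Icc_self hu)))
    have h1 := hf t ht c (hsub (Set.Ioo_subset_Icc_self hc)) hc.1.le
    rw [eq_div_iff (by linarith)] at he
    have h2 : f t * (s - t) ≤ (f c - m * (c - t)) * (s - t) :=
      mul_le_mul_of_nonneg_right (by linarith) (by linarith)
    simp at he
    linarith

/-! ### Calculus of the smoothed edge potential and its flow. -/

section Calculus

variable {q μ : ℝ}

theorem sq_add_sq_pos (hμ : 0 < μ) (t : ℝ) : 0 < t ^ 2 + μ ^ 2 := by positivity

@[simp] theorem flow_zero : flow q μ 0 = 0 := by simp [flow]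

theorem flow_neg (t : ℝ) : flow q μ (-t) = -flow q μ t := by simp [flow]

theorem hasDerivAt_sq_add_sq (t : ℝ) : HasDerivAt (fun t : ℝ => t ^ 2 + μ ^ 2) (2 * t) t := by
  simpa using (hasDerivAt_pow 2 t).add_const (μ ^ 2)

theorem hasDerivAt_potential (hμ : 0 < μ) (t : ℝ) :
    HasDerivAt (fun t : ℝ => (t ^ 2 + μ ^ 2) ^ (q / 2)) (q * flow q μ t) t := by
  refine ((hasDerivAt_sq_add_sq t).rpow_const (Or.inl (sq_add_sq_pos hμ t).ne')).congr_deriv ?_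
  simp only [flow]
  ring

theorem hasDerivAt_flow (hμ : 0 < μ) (t : ℝ) :
    HasDerivAt (flow q μ) ((t ^ 2 + μ ^ 2) ^ (q / 2 - 2) * (μ ^ 2 + (q - 1) * t ^ 2)) t := by
  have h0 := sq_add_sq_pos hμ t
  have h := ((hasDerivAt_sq_add_sq (μ := μ) t).rpow_const (p := q / 2 - 1) (Or.inl h0.ne')).mul
    (hasDerivAt_id t)
  refine h.congr_deriv ?_
  have e : (t ^ 2 + μ ^ 2) ^ (q / 2 - 1) = (t ^ 2 + μ ^ 2) ^ (q / 2 - 2) * (t ^ 2 + μ ^ 2) := by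
    rw [← Real.rpow_add_one h0.ne']; congr 1; ring
  have e2 : q / 2 - 1 - 1 = q / 2 - 2 := by ring
  simp only [e, e2, id]
  ring

/-- Since `q - 1 ≤ 1`, the second factor is at most `t² + μ²`; the remaining power has nonpositive
exponent and is largest at `t = 0`. -/
theorem flow_deriv_le (hμ : 0 < μ) (hq2 : q ≤ 2) (t : ℝ) :
    (t ^ 2 + μ ^ 2) ^ (q / 2 - 2) * (μ ^ 2 + (q - 1) * t ^ 2) ≤ μ ^ (q - 2) := by
  have h0 := sq_add_sq_pos hμ t
  calc (t ^ 2 + μ ^ 2) ^ (q / 2 - 2) * (μ ^ 2 + (q - 1) * t ^ 2)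
      ≤ (t ^ 2 + μ ^ 2) ^ (q / 2 - 2) * (t ^ 2 + μ ^ 2) := by
        refine mul_le_mul_of_nonneg_left ?_ (by positivity)
        nlinarith [sq_nonneg t]
    _ = (t ^ 2 + μ ^ 2) ^ (q / 2 - 1) := by
        rw [← Real.rpow_add_one h0.ne']; congr 1; ring
    _ ≤ (μ ^ 2) ^ (q / 2 - 1) :=
        Real.rpow_le_rpow_of_nonpos (by positivity) (by nlinarith [sq_nonneg t]) (by linarith)
    _ = μ ^ (q - 2) := by
        rw [← Real.rpow_natCast, ← Real.rpow_mul hμ.le]; congr 1; push_cast; ring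

/-- Here `q - 1 ≤ 1` is used on the `μ²` term, and the nonpositive exponent makes `R` the worst
case. -/
theorem le_flow_deriv (hμ : 0 < μ) (hq1 : 1 < q) (hq2 : q ≤ 2) {t R : ℝ}
    (ht : t ^ 2 + μ ^ 2 ≤ R) :
    (q - 1) * R ^ (q / 2 - 1) ≤ (t ^ 2 + μ ^ 2) ^ (q / 2 - 2) * (μ ^ 2 + (q - 1) * t ^ 2) := by
  have h0 := sq_add_sq_pos hμ t
  calc (q - 1) * R ^ (q / 2 - 1) ≤ (q - 1) * (t ^ 2 + μ ^ 2) ^ (q / 2 - 1) :=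
        mul_le_mul_of_nonneg_left (Real.rpow_le_rpow_of_nonpos h0 ht (by linarith)) (by linarith)
    _ = (t ^ 2 + μ ^ 2) ^ (q / 2 - 2) * ((q - 1) * (t ^ 2 + μ ^ 2)) := by
        rw [mul_left_comm, ← Real.rpow_add_one h0.ne']; congr 2; ring
    _ ≤ _ := by
        gcongr; nlinarith [sq_nonneg μ]

theorem flow_sub_le (hμ : 0 < μ) (hq2 : q ≤ 2) {s t : ℝ} (hst : s ≤ t) :
    flow q μ t - flow q μ s ≤ μ ^ (q - 2) * (t - s) := by
  rcases hst.eq_or_lt with rfl | h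
  · simp
  obtain ⟨c, -, he⟩ := exists_hasDerivAt_eq_slope (flow q μ) _ h
    (fun u _ => (hasDerivAt_flow hμ u).continuousAt.continuousWithinAt)
    (fun u _ => hasDerivAt_flow hμ u)
  rw [eq_div_iff (by linarith)] at he
  rw [← he]
  exact mul_le_mul_of_nonneg_right (flow_deriv_le hμ hq2 c) (by linarith)

theorem flow_strictMono (hμ : 0 < μ) (hq1 : 1 < q) : StrictMono (flow q μ) := by
  refine strictMono_of_hasDerivAt_pos (fun t => hasDerivAt_flow hμ t) fun t => ?_
  have h0 := sq_add_sq_pos hμ t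
  have : 0 ≤ (q - 1) * t ^ 2 := mul_nonneg (by linarith) (sq_nonneg t)
  positivity

theorem flow_nonneg {t : ℝ} (ht : 0 ≤ t) : 0 ≤ flow q μ t := by
  unfold flow; positivity

theorem flow_pos (hμ : 0 < μ) {t : ℝ} (ht : 0 < t) : 0 < flow q μ t :=
  mul_pos (Real.rpow_pos_of_pos (sq_add_sq_pos hμ t) _) ht

theorem flow_nonpos {t : ℝ} (ht : t ≤ 0) : flow q μ t ≤ 0 :=
  mul_nonpos_of_nonneg_of_nonpos (Real.rpow_nonneg (by positivity) _) ht

theorem potential_upper_bound (hμ : 0 < μ) (hq1 : 1 < q) (hq2 : q ≤ 2) (s t : ℝ) :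
    1 / q * (s ^ 2 + μ ^ 2) ^ (q / 2) ≤ 1 / q * (t ^ 2 + μ ^ 2) ^ (q / 2)
      + flow q μ t * (s - t) + μ ^ (q - 2) / 2 * (s - t) ^ 2 := by
  -- Negating the potential turns the Lipschitz bound on `flow` into a lower growth rate, with
  -- negative `m`.
  have h := quadratic_lower_bound (g := fun t => -(1 / q * (t ^ 2 + μ ^ 2) ^ (q / 2)))
    (f := fun t => -flow q μ t) (m := -μ ^ (q - 2)) convex_univ
    (fun u _ => ((hasDerivAt_potential hμ u).const_mul (1 / q)).neg.congr_deriv (by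
      have : q ≠ 0 := by linarith
      field_simp))
    (fun u _ v _ huv => by have := flow_sub_le hμ hq2 huv; linarith)
    (Set.mem_univ s) (Set.mem_univ t)
  linarith

theorem potential_lower_bound (hμ : 0 < μ) (hq1 : 1 < q) (hq2 : q ≤ 2) {R s t : ℝ}
    (hs : s ^ 2 + μ ^ 2 ≤ R) (ht : t ^ 2 + μ ^ 2 ≤ R) :
    1 / q * (t ^ 2 + μ ^ 2) ^ (q / 2) + flow q μ t * (s - t)
      + (q - 1) * R ^ (q / 2 - 1) / 2 * (s - t) ^ 2 ≤ 1 / q * (s ^ 2 + μ ^ 2) ^ (q / 2) := by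
  -- The curvature bound holds only for `u² + μ² ≤ R`; written as an interval, this set is visibly
  -- convex.
  have hmem : ∀ u : ℝ, u ∈ Set.Icc (-√(R - μ ^ 2)) (√(R - μ ^ 2)) → u ^ 2 + μ ^ 2 ≤ R := by
    intro u hu
    have h0 : 0 ≤ R - μ ^ 2 := by nlinarith [sq_nonneg s]
    have := Real.sq_sqrt h0
    nlinarith [hu.1, hu.2, Real.sqrt_nonneg (R - μ ^ 2)]
  have hmem' : ∀ u : ℝ, u ^ 2 + μ ^ 2 ≤ R → u ∈ Set.Icc (-√(R - μ ^ 2)) (√(R - μ ^ 2)) :=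
    fun u hu => abs_le.mp (Real.abs_le_sqrt (by linarith))
  refine quadratic_lower_bound (g := fun t => 1 / q * (t ^ 2 + μ ^ 2) ^ (q / 2))
    (convex_Icc (-√(R - μ ^ 2)) (√(R - μ ^ 2)))
    (fun u _ => ((hasDerivAt_potential hμ u).const_mul (1 / q)).congr_deriv (by
      have : q ≠ 0 := by linarith
      field_simp)) ?_ (hmem' s hs) (hmem' t ht)
  intro u hu v hv huv
  rcases huv.eq_or_lt with rfl | h
  · simp
  obtain ⟨c, hc, he⟩ := exists_hasDerivAt_eq_slope (flow q μ) _ h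
    (fun w _ => (hasDerivAt_flow hμ w).continuousAt.continuousWithinAt)
    (fun w _ => hasDerivAt_flow hμ w)
  rw [eq_div_iff (by linarith)] at he
  rw [← he]
  exact mul_le_mul_of_nonneg_right
    (le_flow_deriv hμ hq1 hq2 (hmem c ⟨hu.1.trans hc.1.le, hc.2.le.trans hv.2⟩)) (by linarith)

theorem abs_rpow_le_potential (hq : 0 ≤ q) (t : ℝ) :
    |t| ^ q ≤ (t ^ 2 + μ ^ 2) ^ (q / 2) := by
  have : |t| ^ q = (t ^ 2) ^ (q / 2) := by
    rw [← sq_abs, ← Real.rpow_natCast, ← Real.rpow_mul (abs_nonneg t)]; congr 1; push_cast; ring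
  rw [this]
  exact Real.rpow_le_rpow (sq_nonneg t) (by nlinarith [sq_nonneg μ]) (by linarith)

/-- Subadditivity of `s ↦ s^(q/2)` for `q ≤ 2`: smoothing costs at most `μ^q` per edge. -/
theorem potential_le_abs_rpow_add (hμ : 0 < μ) (hq : 0 ≤ q) (hq2 : q ≤ 2) (t : ℝ) :
    (t ^ 2 + μ ^ 2) ^ (q / 2) ≤ |t| ^ q + μ ^ q := by
  have h1 : ∀ u : ℝ, 0 ≤ u → u ^ q = (u ^ 2) ^ (q / 2) := fun u hu => by
    rw [← Real.rpow_natCast, ← Real.rpow_mul hu]; congr 1; push_cast; ring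
  rw [h1 _ (abs_nonneg t), h1 μ hμ.le, sq_abs]
  exact Real.rpow_add_le_add_rpow (sq_nonneg t) (sq_nonneg μ) (by linarith) (by linarith)

theorem potential_zero (hμ : 0 < μ) : ((0 : ℝ) ^ 2 + μ ^ 2) ^ (q / 2) = μ ^ q := by
  rw [zero_pow two_ne_zero, zero_add, ← Real.rpow_natCast, ← Real.rpow_mul hμ.le]
  congr 1; push_cast; ring

/-- A flow of at most `M - 1` bounds the height difference. -/
theorem sq_add_sq_le_of_flow_le (hμ : 0 < μ) {p M t : ℝ} (hpq : p.HolderConjugate q)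
    (hM : 1 < M) (hμM : μ ≤ 1 / M) (ht : |flow q μ t| ≤ M - 1) :
    t ^ 2 + μ ^ 2 ≤ M ^ (2 * p - 2) := by
  by_contra! hlt
  have h0 := sq_add_sq_pos hμ t
  have hq1 := hpq.symm.lt
  have hp1 := hpq.lt
  have hR1 : 1 ≤ M ^ (2 * p - 2) := Real.one_le_rpow hM.le (by linarith)
  have hMμ : μ * M ≤ 1 := by rwa [le_div_iff₀ (by linarith)] at hμM
  have hpq1 : (p - 1) * (q - 1) = 1 := by
    have := hpq.mul_eq_add; linarith
  have h1 : M ^ 2 ≤ (t ^ 2 + μ ^ 2) ^ (q - 1) := by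
    have : M ^ 2 = (M ^ (2 * p - 2)) ^ (q - 1) := by
      rw [← Real.rpow_mul (by linarith), ← Real.rpow_natCast]
      congr 1; push_cast; linarith
    rw [this]
    exact Real.rpow_le_rpow (by linarith) hlt.le (by linarith)
  have h2 : flow q μ t ^ 2 = (t ^ 2 + μ ^ 2) ^ (q - 1) * (1 - μ ^ 2 / (t ^ 2 + μ ^ 2)) := by
    have e : ((t ^ 2 + μ ^ 2) ^ (q / 2 - 1)) ^ 2 = (t ^ 2 + μ ^ 2) ^ (q - 1) / (t ^ 2 + μ ^ 2) := by
      rw [← Real.rpow_natCast, ← Real.rpow_mul h0.le, ← Real.rpow_sub_one h0.ne']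
      congr 1; push_cast; ring
    -- The squared flow is a power that would be at least `M²`, times a correction factor at least
    -- `1 - μ²`.
    rw [flow, mul_pow, e]; field_simp; ring
  have h3 : flow q μ t ^ 2 ≤ (M - 1) ^ 2 := sq_le_sq' (by linarith [abs_le.mp ht]) (abs_le.mp ht).2
  have h4 : μ ^ 2 / (t ^ 2 + μ ^ 2) ≤ μ ^ 2 :=
    div_le_self (sq_nonneg μ) (by linarith)
  have hμ1 : μ ^ 2 ≤ 1 := by nlinarith
  have h5 : M ^ 2 * (1 - μ ^ 2) ≤ (t ^ 2 + μ ^ 2) ^ (q - 1) * (1 - μ ^ 2 / (t ^ 2 + μ ^ 2)) :=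
    mul_le_mul h1 (by linarith) (by linarith) (by positivity)
  -- Altogether `M² (1 - μ²) ≤ (M - 1)²`, so `2M - 1 ≤ (μM)² ≤ 1`, against `1 < M`.
  nlinarith [mul_pos hμ (by linarith : 0 < M)]

end Calculus

/-! ### Gradient and second-order bounds of the smoothed objective. -/

section Gradient

variable {V : Type} [Fintype V] [DecidableEq V] (G : SimpleGraph V) [DecidableRel G.Adj]
  (q μ : ℝ) (Δ : V → ℝ)

/-- The gradient of the smoothed objective. -/
noncomputable def grad (x : V → ℝ) (i : V) : ℝ :=
  ∑ j ∈ G.neighborFinset i, flow q μ (x i - x j) - (Δ i - G.degree i)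

/-- The energy `∑_{(i,j) ∈ E} (h(i) - h(j))²`. -/
noncomputable def energy (h : V → ℝ) : ℝ := edgeSum G (fun t => t ^ 2) h

variable {G q μ Δ}

theorem sum_neighbor_comm (g : V → V → ℝ) :
    ∑ i, ∑ j ∈ G.neighborFinset i, g i j = ∑ i, ∑ j ∈ G.neighborFinset i, g j i := by
  refine Finset.sum_comm' fun i j => ?_
  simp [G.adj_comm]

/-- Summation by parts: exchanging the endpoints flips the sign of `g`, so both halves of the
difference contribute equally. -/
theorem sum_neighbor_antisymm {g : V → V → ℝ} (hg : ∀ i j, g j i = -g i j) (h : V → ℝ) :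
    ∑ i, ∑ j ∈ G.neighborFinset i, g i j * (h i - h j)
      = 2 * ∑ i, h i * ∑ j ∈ G.neighborFinset i, g i j := by
  have h1 : ∑ i, ∑ j ∈ G.neighborFinset i, g i j * h j
      = -∑ i, h i * ∑ j ∈ G.neighborFinset i, g i j := by
    rw [sum_neighbor_comm fun i j => g i j * h j, ← Finset.sum_neg_distrib]
    refine Finset.sum_congr rfl fun i _ => ?_
    rw [Finset.mul_sum, ← Finset.sum_neg_distrib]
    exact Finset.sum_congr rfl fun j _ => by rw [hg i j]; ring
  have h2 : ∑ i, ∑ j ∈ G.neighborFinset i, g i j * h i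
      = ∑ i, h i * ∑ j ∈ G.neighborFinset i, g i j := by
    refine Finset.sum_congr rfl fun i _ => ?_
    rw [Finset.mul_sum]
    exact Finset.sum_congr rfl fun j _ => mul_comm _ _
  simp only [mul_sub, Finset.sum_sub_distrib]
  rw [h1, h2]; ring

theorem flow_sub_comm (a b : ℝ) : flow q μ (b - a) = -flow q μ (a - b) := by
  rw [← flow_neg, neg_sub]

theorem sum_neighbor_flow (x h : V → ℝ) :
    ∑ i, ∑ j ∈ G.neighborFinset i, flow q μ (x i - x j) * (h i - h j)
      = 2 * ∑ i, h i * ∑ j ∈ G.neighborFinset i, flow q μ (x i - x j) :=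
  sum_neighbor_antisymm (fun i j => flow_sub_comm (x i) (x j)) h

theorem sum_grad_mul (x h : V → ℝ) :
    ∑ i, grad G q μ Δ x i * h i
      = (1 / 2) * ∑ i, ∑ j ∈ G.neighborFinset i, flow q μ (x i - x j) * (h i - h j)
        - linTerm G Δ h := by
  rw [sum_neighbor_flow, linTerm, ← mul_assoc]
  norm_num
  rw [← Finset.sum_sub_distrib]
  exact Finset.sum_congr rfl fun i _ => by rw [grad]; ring

theorem linTerm_sub (x y : V → ℝ) :
    linTerm G Δ (fun i => y i - x i) = linTerm G Δ y - linTerm G Δ x := by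
  simp only [linTerm, sub_mul, Finset.sum_sub_distrib]

theorem Fmu_eq (x : V → ℝ) : Fmu G q μ Δ x
    = (1 / 2) * ∑ i, ∑ j ∈ G.neighborFinset i, 1 / q * ((x i - x j) ^ 2 + μ ^ 2) ^ (q / 2)
      - linTerm G Δ x := by
  simp only [Fmu, edgeSum, ← Finset.mul_sum]; ring

/-- The linear terms cancel, leaving a sum of one-variable Taylor remainders, to which the scalar
potential bounds apply edge by edge. -/
theorem Fmu_taylor (x y : V → ℝ) :
    Fmu G q μ Δ y - Fmu G q μ Δ x - ∑ i, grad G q μ Δ x i * (y i - x i)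
      = (1 / 2) * ∑ i, ∑ j ∈ G.neighborFinset i,
          (1 / q * ((y i - y j) ^ 2 + μ ^ 2) ^ (q / 2)
            - 1 / q * ((x i - x j) ^ 2 + μ ^ 2) ^ (q / 2)
            - flow q μ (x i - x j) * ((y i - y j) - (x i - x j))) := by
  have e : ∀ i j, (y i - y j) - (x i - x j) = (y i - x i) - (y j - x j) := fun i j => by ring
  rw [sum_grad_mul x fun i => y i - x i, Fmu_eq, Fmu_eq, linTerm_sub]
  simp only [Finset.sum_sub_distrib, e]
  ring

theorem energy_eq (h : V → ℝ) :
    energy G h = (1 / 2) * ∑ i, ∑ j ∈ G.neighborFinset i, (h i - h j) ^ 2 := rfl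

theorem Fmu_upper_bound (hμ : 0 < μ) (hq1 : 1 < q) (hq2 : q ≤ 2) (x y : V → ℝ) :
    Fmu G q μ Δ y ≤ Fmu G q μ Δ x + ∑ i, grad G q μ Δ x i * (y i - x i)
      + μ ^ (q - 2) / 2 * energy G (fun i => y i - x i) := by
  have h := Fmu_taylor (G := G) (q := q) (μ := μ) (Δ := Δ) x y
  have h2 : (1 / 2) * ∑ i, ∑ j ∈ G.neighborFinset i,
          (1 / q * ((y i - y j) ^ 2 + μ ^ 2) ^ (q / 2)
            - 1 / q * ((x i - x j) ^ 2 + μ ^ 2) ^ (q / 2)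
            - flow q μ (x i - x j) * ((y i - y j) - (x i - x j)))
      ≤ μ ^ (q - 2) / 2 * energy G (fun i => y i - x i) := by
    rw [energy_eq, mul_left_comm, Finset.mul_sum _ _ (μ ^ (q - 2) / 2)]
    refine mul_le_mul_of_nonneg_left (Finset.sum_le_sum fun i _ => ?_) (by norm_num : (0 : ℝ) ≤ 1 / 2)
    rw [Finset.mul_sum]
    refine Finset.sum_le_sum fun j _ => ?_
    have := potential_upper_bound hμ hq1 hq2 (y i - y j) (x i - x j)
    rw [show (y i - x i) - (y j - x j) = (y i - y j) - (x i - x j) by ring]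
    linarith
  linarith

theorem Fmu_lower_bound (hμ : 0 < μ) (hq1 : 1 < q) (hq2 : q ≤ 2) {R : ℝ} {x y : V → ℝ}
    (hx : ∀ i j, G.Adj i j → (x i - x j) ^ 2 + μ ^ 2 ≤ R)
    (hy : ∀ i j, G.Adj i j → (y i - y j) ^ 2 + μ ^ 2 ≤ R) :
    Fmu G q μ Δ x + ∑ i, grad G q μ Δ x i * (y i - x i)
      + (q - 1) * R ^ (q / 2 - 1) / 2 * energy G (fun i => y i - x i) ≤ Fmu G q μ Δ y := by
  have h := Fmu_taylor (G := G) (q := q) (μ := μ) (Δ := Δ) x y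
  have h2 : (q - 1) * R ^ (q / 2 - 1) / 2 * energy G (fun i => y i - x i)
      ≤ (1 / 2) * ∑ i, ∑ j ∈ G.neighborFinset i,
          (1 / q * ((y i - y j) ^ 2 + μ ^ 2) ^ (q / 2)
            - 1 / q * ((x i - x j) ^ 2 + μ ^ 2) ^ (q / 2)
            - flow q μ (x i - x j) * ((y i - y j) - (x i - x j))) := by
    rw [energy_eq, mul_left_comm, Finset.mul_sum _ _ ((q - 1) * R ^ (q / 2 - 1) / 2)]
    refine mul_le_mul_of_nonneg_left (Finset.sum_le_sum fun i _ => ?_) (by norm_num : (0 : ℝ) ≤ 1 / 2)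
    rw [Finset.mul_sum]
    refine Finset.sum_le_sum fun j hj => ?_
    rw [SimpleGraph.mem_neighborFinset] at hj
    have := potential_lower_bound hμ hq1 hq2 (hy i j hj) (hx i j hj)
    rw [show (y i - x i) - (y j - x j) = (y i - y j) - (x i - x j) by ring]
    linarith
  linarith

/-- Only the edges at `i` change, each by `s`; hence `deg(i) μ^(q-2)` is the smoothness constant of
coordinate `i`. -/
theorem energy_update_sub (x : V → ℝ) (i : V) (s : ℝ) :
    energy G (fun k => Function.update x i (x i + s) k - x k) = G.degree i * s ^ 2 := by
  have e : (fun k => Function.update x i (x i + s) k - x k) = Pi.single i s := by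
    ext k
    by_cases hk : k = i
    · subst hk; simp
    · simp [hk]
  -- Adjacent nodes are distinct, so the cross term vanishes.
  have hsq : ∀ k, ∀ j ∈ G.neighborFinset k, ((Pi.single i s : V → ℝ) k - (Pi.single i s : V → ℝ) j) ^ 2
      = (Pi.single i (s ^ 2) : V → ℝ) k + (Pi.single i (s ^ 2) : V → ℝ) j := by
    intro k j hj
    rw [SimpleGraph.mem_neighborFinset] at hj
    by_cases hk : k = i
    · subst hk
      simp [hj.ne']
    · by_cases hj' : j = i
      · subst hj'; simp [hk]
      · simp [hk, hj']
  rw [e, energy_eq, Finset.sum_congr rfl fun k _ => Finset.sum_congr rfl (hsq k)]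
  simp only [Finset.sum_add_distrib]
  rw [← sum_neighbor_comm fun k _ => (Pi.single i (s ^ 2) : V → ℝ) k]
  simp only [Finset.sum_const, SimpleGraph.card_neighborFinset_eq_degree, nsmul_eq_mul]
  rw [Finset.sum_eq_single i (fun k _ hk => by simp [hk]) (by simp)]
  simp
  ring

theorem sum_mul_update_sub (g x : V → ℝ) (i : V) (s : ℝ) :
    ∑ k, g k * (Function.update x i (x i + s) k - x k) = g i * s := by
  rw [Finset.sum_eq_single i (fun k _ hk => by simp [hk]) (by simp)]
  simp

theorem Fmu_update_le (hμ : 0 < μ) (hq1 : 1 < q) (hq2 : q ≤ 2) (x : V → ℝ) (i : V) (s : ℝ) :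
    Fmu G q μ Δ (Function.update x i (x i + s)) ≤ Fmu G q μ Δ x + grad G q μ Δ x i * s
      + G.degree i * μ ^ (q - 2) / 2 * s ^ 2 := by
  have h := Fmu_upper_bound (G := G) (Δ := Δ) hμ hq1 hq2 x (Function.update x i (x i + s))
  rw [energy_update_sub, sum_mul_update_sub] at h
  linarith

theorem partialDeriv_Fmu (hμ : 0 < μ) (hq : q ≠ 0) (i : V) (x : V → ℝ) :
    partialDeriv (Fmu G q μ Δ) i x = grad G q μ Δ x i := by
  have hup : ∀ k, HasDerivAt (fun t => Function.update x i t k) ((Pi.single i 1 : V → ℝ) k) (x i) :=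
    fun k => (hasDerivAt_pi.mp (hasDerivAt_update x i (x i))) k
  have hedge : ∀ k j, HasDerivAt
      (fun t => 1 / q * ((Function.update x i t k - Function.update x i t j) ^ 2 + μ ^ 2) ^ (q / 2))
      (flow q μ (x k - x j) * ((Pi.single i 1 : V → ℝ) k - (Pi.single i 1 : V → ℝ) j)) (x i) := by
    intro k j
    have h := ((hasDerivAt_potential (q := q) hμ (x k - x j)).const_mul (1 / q)).comp_of_eq (x i)
      ((hup k).sub (hup j)) (by simp)
    refine h.congr_deriv ?_
    field_simp
  have hd : HasDerivAt (fun t => Fmu G q μ Δ (Function.update x i t))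
      ((1 / 2) * ∑ k, ∑ j ∈ G.neighborFinset k,
        flow q μ (x k - x j) * ((Pi.single i 1 : V → ℝ) k - (Pi.single i 1 : V → ℝ) j)
        - linTerm G Δ (Pi.single i 1)) (x i) := by
    simp only [Fmu_eq]
    refine HasDerivAt.sub (HasDerivAt.const_mul _ (HasDerivAt.fun_sum fun k _ =>
      HasDerivAt.fun_sum fun j _ => hedge k j)) ?_
    exact HasDerivAt.fun_sum fun k _ => (hup k).mul_const _
  rw [partialDeriv, hd.deriv, ← sum_grad_mul]
  rw [Finset.sum_eq_single i (fun k _ hk => by simp [hk]) (by simp)]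
  simp

end Gradient

/-! ### Optimality conditions, conservation on level sets, and a Poincaré inequality. -/

section Optimum

variable {V : Type} [Fintype V] [DecidableEq V] {G : SimpleGraph V} [DecidableRel G.Adj]
  {q μ : ℝ} {Δ : V → ℝ}

theorem mem_supp {x : V → ℝ} {v : V} : v ∈ supp x ↔ x v ≠ 0 := by simp [supp]

theorem update_add_nonneg {x : V → ℝ} (hx : 0 ≤ x) {i : V} {s : ℝ} (hs : 0 ≤ x i + s) :
    0 ≤ Function.update x i (x i + s) := by
  intro k
  by_cases hk : k = i
  · subst hk; simpa using hs
  · simpa [hk] using hx k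

/-- Otherwise raising coordinate `i` by `-g / L`, which is always feasible, would decrease the
objective. -/
theorem IsSmoothedOptimum.grad_nonneg (hμ : 0 < μ) (hq1 : 1 < q) (hq2 : q ≤ 2) {xs : V → ℝ}
    (h : IsSmoothedOptimum G q μ Δ xs) {i : V} (hi : 0 < G.degree i) :
    0 ≤ grad G q μ Δ xs i := by
  by_contra! hneg
  set g := grad G q μ Δ xs i
  set L := (G.degree i : ℝ) * μ ^ (q - 2)
  have hL : 0 < L := mul_pos (by exact_mod_cast hi) (Real.rpow_pos_of_pos hμ _)
  have hs : 0 < -g / L := div_pos (by linarith) hL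
  have h1 := Fmu_update_le (G := G) (Δ := Δ) hμ hq1 hq2 xs i (-g / L)
  have h2 := h.2 _ (update_add_nonneg h.1 (add_nonneg (h.1 i) hs.le))
  have h3 : L * (-g / L) = -g := mul_div_cancel₀ _ hL.ne'
  have h4 : g * (-g / L) + L / 2 * (-g / L) ^ 2 = g / 2 * (-g / L) := by
    linear_combination (-g / L) / 2 * h3
  have h5 : g / 2 * (-g / L) < 0 := mul_neg_of_neg_of_pos (by linarith) hs
  linarith

theorem IsSmoothedOptimum.grad_eq_zero (hμ : 0 < μ) (hq1 : 1 < q) (hq2 : q ≤ 2) {xs : V → ℝ}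
    (h : IsSmoothedOptimum G q μ Δ xs) {i : V} (hi : 0 < G.degree i) (hx : xs i ≠ 0) :
    grad G q μ Δ xs i = 0 := by
  refine le_antisymm ?_ (h.grad_nonneg hμ hq1 hq2 hi)
  by_contra! hpos
  set g := grad G q μ Δ xs i
  set L := (G.degree i : ℝ) * μ ^ (q - 2)
  have hL : 0 < L := mul_pos (by exact_mod_cast hi) (Real.rpow_pos_of_pos hμ _)
  have hxi : 0 < xs i := lt_of_le_of_ne (h.1 i) (Ne.symm hx)
  -- Now the coordinate is lowered, and the step is truncated to keep it nonnegative.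
  set s := min (g / L) (xs i)
  have hs : 0 < s := lt_min (div_pos hpos hL) hxi
  have h1 := Fmu_update_le (G := G) (Δ := Δ) hμ hq1 hq2 xs i (-s)
  have h2 := h.2 _ (update_add_nonneg h.1 (s := -s) (by have := min_le_right (g / L) (xs i); linarith))
  have h3 : s * L ≤ g := (le_div_iff₀ hL).mp (min_le_left _ _)
  nlinarith

/-- The mass that leaves an upper level set of the heights is conserved. -/
theorem sum_flow_upper_set (x : V → ℝ) (A : Finset V) :
    ∑ a ∈ A, ∑ b ∈ G.neighborFinset a, flow q μ (x a - x b)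
      = (1 / 2) * ∑ a, ∑ b ∈ G.neighborFinset a, flow q μ (x a - x b)
          * ((if a ∈ A then 1 else 0) - (if b ∈ A then 1 else 0)) := by
  rw [sum_neighbor_flow x fun a => if a ∈ A then 1 else 0]
  simp

theorem flow_mul_indicator_nonneg {x : V → ℝ} {A : Finset V}
    (hA : ∀ a ∈ A, ∀ b ∉ A, x b ≤ x a) (a b : V) :
    0 ≤ flow q μ (x a - x b) * ((if a ∈ A then 1 else 0) - (if b ∈ A then 1 else 0)) := by
  by_cases ha : a ∈ A <;> by_cases hb : b ∈ A <;> simp only [ha, hb, if_true, if_false]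
  · simp
  · simpa using flow_nonneg (sub_nonneg.mpr (hA a ha b hb))
  · simpa using flow_nonpos (sub_nonpos.mpr (hA b hb a ha))
  · simp

/-- A nonpositive gradient says that degree plus net outflow is covered by the source of the node.
-/
theorem sum_flow_le {x : V → ℝ} {A : Finset V} (hΔ : 0 ≤ Δ)
    (hg : ∀ a ∈ A, grad G q μ Δ x a ≤ 0) :
    ∑ a ∈ A, (G.degree a : ℝ) + ∑ a ∈ A, ∑ b ∈ G.neighborFinset a, flow q μ (x a - x b)
      ≤ mass Δ := by
  calc _ = ∑ a ∈ A, (grad G q μ Δ x a + Δ a) := by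
        rw [← Finset.sum_add_distrib]
        exact Finset.sum_congr rfl fun a _ => by rw [grad]; ring
    _ ≤ ∑ a ∈ A, Δ a := Finset.sum_le_sum fun a ha => by have := hg a ha; linarith
    _ ≤ mass Δ := Finset.sum_le_sum_of_subset_of_nonneg (Finset.subset_univ A) fun a _ _ => hΔ a

theorem volume_le_mass {x : V → ℝ} {A : Finset V} (hΔ : 0 ≤ Δ)
    (hA : ∀ a ∈ A, ∀ b ∉ A, x b ≤ x a) (hg : ∀ a ∈ A, grad G q μ Δ x a ≤ 0) :
    ∑ a ∈ A, (G.degree a : ℝ) ≤ mass Δ := by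
  have h1 := sum_flow_le hΔ hg
  have h2 : 0 ≤ ∑ a ∈ A, ∑ b ∈ G.neighborFinset a, flow q μ (x a - x b) := by
    rw [sum_flow_upper_set]
    exact mul_nonneg (by norm_num) (Finset.sum_nonneg fun a _ => Finset.sum_nonneg fun b _ =>
      flow_mul_indicator_nonneg hA a b)
  linarith

/-- All flow across the boundary of `A` points outward, so the flow of one crossing edge cannot be
cancelled by the others. -/
theorem volume_add_flow_le_mass {x : V → ℝ} {A : Finset V} (hΔ : 0 ≤ Δ)
    (hA : ∀ a ∈ A, ∀ b ∉ A, x b ≤ x a) (hg : ∀ a ∈ A, grad G q μ Δ x a ≤ 0)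
    {i j : V} (hi : i ∈ A) (hj : j ∉ A) (hij : G.Adj i j) :
    ∑ a ∈ A, (G.degree a : ℝ) + flow q μ (x i - x j) ≤ mass Δ := by
  have h1 := sum_flow_le hΔ hg
  rw [sum_flow_upper_set] at h1
  set T : V → V → ℝ := fun a b =>
    flow q μ (x a - x b) * ((if a ∈ A then 1 else 0) - (if b ∈ A then 1 else 0)) with hT
  have hT0 : ∀ a b, 0 ≤ T a b := flow_mul_indicator_nonneg hA
  have h2 : ∀ {a b}, G.Adj a b → T a b ≤ ∑ b ∈ G.neighborFinset a, T a b := fun {a b} hab =>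
    Finset.single_le_sum (f := T a) (fun b _ => hT0 a b) (by simpa using hab)
  -- The edge occurs in both directions in the double sum, which compensates the factor `1/2`.
  have h3 : ∑ a ∈ {i, j}, ∑ b ∈ G.neighborFinset a, T a b
      ≤ ∑ a, ∑ b ∈ G.neighborFinset a, T a b :=
    Finset.sum_le_sum_of_subset_of_nonneg (Finset.subset_univ _)
      fun a _ _ => Finset.sum_nonneg fun b _ => hT0 a b
  rw [Finset.sum_pair hij.ne] at h3
  have h4 : T i j = flow q μ (x i - x j) := by simp [hT, hi, hj]
  have h5 : T j i = flow q μ (x i - x j) := by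
    simp [hT, hi, hj, flow_sub_comm (q := q) (μ := μ) (x i) (x j)]
  have h6 := h2 hij
  have h7 := h2 hij.symm
  linarith

theorem exists_boundary_edge (hG : G.Connected) {S : Finset V} (hS : S.Nonempty)
    (hS' : S ≠ Finset.univ) : ∃ i ∈ S, ∃ j ∉ S, G.Adj i j := by
  obtain ⟨i, hi⟩ := hS
  obtain ⟨j, hj⟩ : ∃ j, j ∉ S := by
    by_contra! h
    exact hS' (Finset.eq_univ_iff_forall.mpr h)
  obtain ⟨w⟩ := hG.preconnected i j
  obtain ⟨d, -, h1, h2⟩ := w.exists_boundary_dart (S : Set V) (by simpa using hi) (by simpa using hj)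
  exact ⟨d.fst, by simpa using h1, d.snd, by simpa using h2, d.adj⟩

/-- A simple path uses no edge twice, so its steps in both orientations are distinct terms of the
double sum defining the energy. -/
theorem sum_path_le_energy {i j : V} (w : G.Walk i j) (hw : w.IsPath) (h : V → ℝ) :
    ∑ k ∈ Finset.range w.length, (h (w.getVert k) - h (w.getVert (k + 1))) ^ 2 ≤ energy G h := by
  set T : V × V → ℝ := fun e => (h e.1 - h e.2) ^ 2
  set E : Finset (V × V) := Finset.univ.filter fun e => G.Adj e.1 e.2
  have hE : energy G h = (1 / 2) * ∑ e ∈ E, T e := by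
    rw [energy_eq, Finset.sum_filter, ← Finset.univ_product_univ, Finset.sum_product]
    congr 1
    refine Finset.sum_congr rfl fun a _ => ?_
    rw [← Finset.sum_filter]
    refine Finset.sum_congr ?_ fun _ _ => rfl
    ext b; simp
  set f₁ : ℕ → V × V := fun k => (w.getVert k, w.getVert (k + 1))
  set f₂ : ℕ → V × V := fun k => (w.getVert (k + 1), w.getVert k)
  have inj : ∀ {a b : ℕ}, a ≤ w.length → b ≤ w.length → w.getVert a = w.getVert b → a = b :=
    fun ha hb hab => hw.getVert_injOn (by simpa using ha) (by simpa using hb) hab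
  have hdisj : Disjoint ((Finset.range w.length).image f₁) ((Finset.range w.length).image f₂) := by
    rw [Finset.disjoint_left]
    intro e h1 h2
    obtain ⟨a, ha, rfl⟩ := Finset.mem_image.mp h1
    obtain ⟨b, hb, hab⟩ := Finset.mem_image.mp h2
    rw [Finset.mem_range] at ha hb
    have e1 := inj (by omega) (by omega) (congrArg Prod.fst hab)
    have e2 := inj (by omega) (by omega) (congrArg Prod.snd hab)
    omega
  have hsub : (Finset.range w.length).image f₁ ∪ (Finset.range w.length).image f₂ ⊆ E := by
    intro e he
    rw [Finset.mem_union, Finset.mem_image, Finset.mem_image] at he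
    rcases he with ⟨a, ha, rfl⟩ | ⟨a, ha, rfl⟩ <;> rw [Finset.mem_range] at ha
    · simpa [E, f₁] using w.adj_getVert_succ ha
    · simpa [E, f₂] using (w.adj_getVert_succ ha).symm
  have hle := Finset.sum_le_sum_of_subset_of_nonneg (f := T) hsub fun e _ _ => sq_nonneg _
  rw [Finset.sum_union hdisj, Finset.sum_image, Finset.sum_image] at hle
  · have e2 : ∑ k ∈ Finset.range w.length, T (f₂ k) = ∑ k ∈ Finset.range w.length, T (f₁ k) :=
      Finset.sum_congr rfl fun k _ => by simp only [T, f₁, f₂]; ring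
    rw [e2] at hle
    rw [hE]
    change ∑ k ∈ Finset.range w.length, T (f₁ k) ≤ _
    linarith
  · intro a ha b hb hab
    simp at ha hb
    exact inj (by omega) (by omega) (congrArg Prod.snd hab)
  · intro a ha b hb hab
    simp at ha hb
    exact inj (by omega) (by omega) (congrArg Prod.fst hab)

/-- A shortest path from `i` to the nearest node outside `S` has all earlier nodes in `S`, hence at
most `|S|` edges. Telescope `h` along it and apply Cauchy–Schwarz. -/
theorem sq_le_card_mul_energy (hG : G.Connected) {S : Finset V} (hS' : S ≠ Finset.univ)
    {h : V → ℝ} (hh : ∀ v ∉ S, h v = 0) (i : V) : h i ^ 2 ≤ S.card * energy G h := by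
  have hne : (Sᶜ).Nonempty := by
    rw [Finset.nonempty_iff_ne_empty]
    simpa using hS'
  obtain ⟨j, hj, hmin⟩ := Finset.exists_min_image Sᶜ (G.dist i) hne
  rw [Finset.mem_compl] at hj
  obtain ⟨w, hw, hlen⟩ := hG.exists_path_of_dist i j
  have hmem : ∀ k, k < w.length → w.getVert k ∈ S := by
    intro k hk
    by_contra hc
    have h1 := hmin _ (Finset.mem_compl.mpr hc)
    have h2 : G.dist i (w.getVert k) ≤ k := by
      have := SimpleGraph.dist_le (w.take k)
      rw [SimpleGraph.Walk.take_length] at this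
      omega
    omega
  have hcard : w.length ≤ S.card := by
    rw [← Finset.card_range w.length]
    refine Finset.card_le_card_of_injOn w.getVert (fun k hk => hmem k (by simpa using hk)) ?_
    intro a ha b hb hab
    simp at ha hb
    exact hw.getVert_injOn (by simp; omega) (by simp; omega) hab
  have htel : h i = ∑ k ∈ Finset.range w.length, (h (w.getVert k) - h (w.getVert (k + 1))) := by
    rw [Finset.sum_range_sub' fun k => h (w.getVert k)]
    simp [hh j hj]
  have hE := sum_path_le_energy w hw h
  have hE0 : 0 ≤ energy G h := (Finset.sum_nonneg fun _ _ => sq_nonneg _).trans hE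
  calc h i ^ 2 ≤ (Finset.range w.length).card
          * ∑ k ∈ Finset.range w.length, (h (w.getVert k) - h (w.getVert (k + 1))) ^ 2 := by
        rw [htel]; exact sq_sum_le_card_mul_sum_sq
    _ ≤ S.card * energy G h := by
        rw [Finset.card_range]
        exact mul_le_mul (by exact_mod_cast hcard) hE (Finset.sum_nonneg fun _ _ => sq_nonneg _)
          (Nat.cast_nonneg _)

/-- Poincaré inequality for vectors that vanish off a proper subset of the nodes. -/
theorem sum_sq_le_energy (hG : G.Connected) {S : Finset V} (hS' : S ≠ Finset.univ)
    {h : V → ℝ} (hh : ∀ v ∉ S, h v = 0) : ∑ v, h v ^ 2 ≤ (S.card : ℝ) ^ 2 * energy G h := by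
  calc ∑ v, h v ^ 2 = ∑ v ∈ S, h v ^ 2 :=
        (Finset.sum_subset (Finset.subset_univ S) fun v _ hv => by simp [hh v hv]).symm
    _ ≤ ∑ _v ∈ S, S.card * energy G h :=
        Finset.sum_le_sum fun v _ => sq_le_card_mul_energy hG hS' hh v
    _ = _ := by rw [Finset.sum_const, nsmul_eq_mul]; ring

end Optimum

/-! ### Standing assumptions, effect of one coordinate update, and smoothing error. -/

/-- A diffusion problem with a small smoothing parameter, and its smoothed optimum. -/
structure Instance {V : Type} [Fintype V] [DecidableEq V] (G : SimpleGraph V)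
    [DecidableRel G.Adj] (p q μ : ℝ) (Δ xs : V → ℝ) : Prop where
  holder : p.HolderConjugate q
  q_le_two : q ≤ 2
  μ_pos : 0 < μ
  μ_le : μ ≤ 1 / mass Δ
  connected : G.Connected
  source_nonneg : 0 ≤ Δ
  mass_lt_volume : mass Δ < volume G
  exists_excess : ∃ v, (G.degree v : ℝ) < Δ v
  optimum : IsSmoothedOptimum G q μ Δ xs

/-- The invariant of the coordinate method. -/
structure Below {V : Type} [Fintype V] [DecidableEq V] (G : SimpleGraph V)
    [DecidableRel G.Adj] (q μ : ℝ) (Δ xs x : V → ℝ) : Prop where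
  nonneg : 0 ≤ x
  le : x ≤ xs
  grad_nonpos : ∀ v, 0 < x v → grad G q μ Δ x v ≤ 0

section

variable {V : Type} [Fintype V] [DecidableEq V] {G : SimpleGraph V} [DecidableRel G.Adj]
  {p q μ : ℝ} {Δ xs x : V → ℝ}

/-- A connected graph has an isolated node only if it has a single node, and then its volume is
zero. -/
theorem degree_pos_of_mass_lt_volume (hG : G.Connected) (hΔ : 0 ≤ Δ)
    (hvol : mass Δ < volume G) (v : V) : 0 < G.degree v := by
  have h0 : 0 ≤ mass Δ := Finset.sum_nonneg fun v _ => hΔ v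
  have : Nontrivial V := by
    by_contra hn
    rw [not_nontrivial_iff_subsingleton] at hn
    have : volume G = 0 := Finset.sum_eq_zero fun v _ => by
      rw [Nat.cast_eq_zero, ← SimpleGraph.card_neighborFinset_eq_degree, Finset.card_eq_zero,
        Finset.eq_empty_iff_forall_notMem]
      intro w hw
      rw [SimpleGraph.mem_neighborFinset] at hw
      exact hw.ne (Subsingleton.elim _ _)
    linarith
  exact hG.preconnected.degree_pos_of_nontrivial v

theorem source_le_mass (hΔ : 0 ≤ Δ) (v : V) : Δ v ≤ mass Δ :=
  Finset.single_le_sum (f := Δ) (fun v _ => hΔ v) (Finset.mem_univ v)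

theorem one_lt_mass (hG : G.Connected) (hΔ : 0 ≤ Δ) (hvol : mass Δ < volume G)
    (hex : ∃ v, (G.degree v : ℝ) < Δ v) : 1 < mass Δ := by
  obtain ⟨v, hv⟩ := hex
  have h1 : (1 : ℝ) ≤ G.degree v := by
    exact_mod_cast degree_pos_of_mass_lt_volume hG hΔ hvol v
  have := source_le_mass hΔ v
  linarith

theorem negSet_eq (hμ : 0 < μ) (hq : q ≠ 0) (x : V → ℝ) :
    negSet G q μ Δ x = Finset.univ.filter fun i => grad G q μ Δ x i < 0 := by
  ext i
  simp [negSet, partialDeriv_Fmu hμ hq]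

theorem mem_negSet (hμ : 0 < μ) (hq : q ≠ 0) {x : V → ℝ} {i : V} :
    i ∈ negSet G q μ Δ x ↔ grad G q μ Δ x i < 0 := by
  simp [negSet_eq hμ hq]

theorem coordStep_eq (hμ : 0 < μ) (hq : q ≠ 0) (x : V → ℝ) (i : V) :
    coordStep G q μ Δ x i
      = Function.update x i (x i + -(μ ^ (2 - q) / G.degree i * grad G q μ Δ x i)) := by
  rw [coordStep, partialDeriv_Fmu hμ hq, sub_eq_add_neg]

/-- Raising `i` lowers the height difference from `v` to `i` when they are adjacent, and `flow` is
increasing. -/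
theorem grad_update_other_le (hμ : 0 < μ) (hq1 : 1 < q) {s : ℝ} (hs : 0 ≤ s) {i v : V}
    (hv : v ≠ i) (x : V → ℝ) :
    grad G q μ Δ (Function.update x i (x i + s)) v ≤ grad G q μ Δ x v := by
  unfold grad
  refine sub_le_sub_right (Finset.sum_le_sum fun j _ =>
    (flow_strictMono hμ hq1).monotone ?_) _
  by_cases hj : j = i
  · subst hj
    simp [hv]
    linarith
  · simp [hv, hj]

theorem grad_update_self_le (hμ : 0 < μ) (hq2 : q ≤ 2) {s : ℝ} (hs : 0 ≤ s)
    (i : V) (x : V → ℝ) :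
    grad G q μ Δ (Function.update x i (x i + s)) i
      ≤ grad G q μ Δ x i + G.degree i * μ ^ (q - 2) * s := by
  have h : ∑ j ∈ G.neighborFinset i, flow q μ (Function.update x i (x i + s) i
        - Function.update x i (x i + s) j)
      ≤ ∑ j ∈ G.neighborFinset i, (flow q μ (x i - x j) + μ ^ (q - 2) * s) := by
    refine Finset.sum_le_sum fun j hj => ?_
    rw [SimpleGraph.mem_neighborFinset] at hj
    have h1 := flow_sub_le (q := q) hμ hq2 (s := x i - x j) (t := x i + s - x j) (by linarith)
    rw [show x i + s - x j - (x i - x j) = s by ring] at h1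
    simp [hj.ne']
    linarith
  rw [Finset.sum_add_distrib, Finset.sum_const, SimpleGraph.card_neighborFinset_eq_degree,
    nsmul_eq_mul] at h
  unfold grad
  linarith

/-- On an edge with both ends off `S`, smoothing adds exactly `μ^q` to the term of `x`, which
offsets the excess at `y`. Only edges touching `S` pay, so the error does not grow with the graph.
-/
theorem edgeSum_diff_le (hμ : 0 < μ) (hq1 : 1 < q) (hq2 : q ≤ 2) {S : Finset V}
    (hx : ∀ v ∉ S, x v = 0) (y : V → ℝ) :
    F G q Δ x - Fmu G q μ Δ x + (Fmu G q μ Δ y - F G q Δ y)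
      ≤ μ ^ q * ∑ v ∈ S, (G.degree v : ℝ) := by
  have hq : 0 ≤ q := by linarith
  have hedge : ∀ i j, |x i - x j| ^ q - ((x i - x j) ^ 2 + μ ^ 2) ^ (q / 2)
      + (((y i - y j) ^ 2 + μ ^ 2) ^ (q / 2) - |y i - y j| ^ q)
      ≤ (if i ∈ S then μ ^ q else 0) + (if j ∈ S then μ ^ q else 0) := by
    intro i j
    have hy := potential_le_abs_rpow_add hμ hq hq2 (y i - y j)
    have hx1 := abs_rpow_le_potential (μ := μ) hq (x i - x j)
    have hμq : 0 ≤ μ ^ q := Real.rpow_nonneg hμ.le q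
    by_cases hi : i ∈ S <;> by_cases hj : j ∈ S <;> simp only [hi, hj, if_true, if_false]
    · linarith
    · linarith
    · linarith
    · rw [hx i hi, hx j hj, sub_zero, potential_zero hμ, abs_zero,
        Real.zero_rpow (by linarith)]
      linarith
  have hdeg : ∑ i, ∑ _j ∈ G.neighborFinset i, (if i ∈ S then μ ^ q else 0)
      = μ ^ q * ∑ v ∈ S, (G.degree v : ℝ) := by
    simp only [Finset.sum_const, SimpleGraph.card_neighborFinset_eq_degree, nsmul_eq_mul]
    rw [Finset.mul_sum]
    simp [mul_comm]
  have hsum : ∑ i, ∑ j ∈ G.neighborFinset i, (|x i - x j| ^ q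
      - ((x i - x j) ^ 2 + μ ^ 2) ^ (q / 2)
      + (((y i - y j) ^ 2 + μ ^ 2) ^ (q / 2) - |y i - y j| ^ q))
      ≤ 2 * (μ ^ q * ∑ v ∈ S, (G.degree v : ℝ)) := by
    refine (Finset.sum_le_sum fun i _ => Finset.sum_le_sum fun j _ => hedge i j).trans ?_
    simp only [Finset.sum_add_distrib]
    rw [← sum_neighbor_comm fun i _ => if i ∈ S then μ ^ q else 0, hdeg]
    linarith
  simp only [Finset.sum_add_distrib, Finset.sum_sub_distrib] at hsum
  have h0 : 0 ≤ μ ^ q * ∑ v ∈ S, (G.degree v : ℝ) :=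
    mul_nonneg (Real.rpow_nonneg hμ.le q) (Finset.sum_nonneg fun _ _ => Nat.cast_nonneg _)
  calc F G q Δ x - Fmu G q μ Δ x + (Fmu G q μ Δ y - F G q Δ y)
      = 1 / q * ((1 / 2) * (∑ i, ∑ j ∈ G.neighborFinset i, |x i - x j| ^ q
        - ∑ i, ∑ j ∈ G.neighborFinset i, ((x i - x j) ^ 2 + μ ^ 2) ^ (q / 2)
        + (∑ i, ∑ j ∈ G.neighborFinset i, ((y i - y j) ^ 2 + μ ^ 2) ^ (q / 2)
          - ∑ i, ∑ j ∈ G.neighborFinset i, |y i - y j| ^ q))) := by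
        simp only [F, Fmu, edgeSum]; ring
    _ ≤ 1 / q * (μ ^ q * ∑ v ∈ S, (G.degree v : ℝ)) := by
        refine mul_le_mul_of_nonneg_left ?_ (by positivity)
        linarith
    _ ≤ 1 * (μ ^ q * ∑ v ∈ S, (G.degree v : ℝ)) :=
        mul_le_mul_of_nonneg_right (by rw [div_le_one (by linarith)]; exact hq1.le) h0
    _ = _ := one_mul _

end

/-! ### Locality, invariance, strong convexity and contraction. -/

namespace Instance

variable {V : Type} [Fintype V] [DecidableEq V] {G : SimpleGraph V} [DecidableRel G.Adj]
  {p q μ : ℝ} {Δ xs x : V → ℝ}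

theorem one_lt_q (I : Instance G p q μ Δ xs) : 1 < q := I.holder.symm.lt

theorem one_lt_p (I : Instance G p q μ Δ xs) : 1 < p := I.holder.lt

theorem q_ne_zero (I : Instance G p q μ Δ xs) : q ≠ 0 := by linarith [I.one_lt_q]

theorem degree_pos (I : Instance G p q μ Δ xs) (v : V) : 0 < G.degree v :=
  degree_pos_of_mass_lt_volume I.connected I.source_nonneg I.mass_lt_volume v

theorem one_lt_mass (I : Instance G p q μ Δ xs) : 1 < mass Δ :=
  FlowDiffusion.one_lt_mass I.connected I.source_nonneg I.mass_lt_volume I.exists_excess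

theorem grad_nonneg (I : Instance G p q μ Δ xs) (v : V) : 0 ≤ grad G q μ Δ xs v :=
  I.optimum.grad_nonneg I.μ_pos I.one_lt_q I.q_le_two (I.degree_pos v)

theorem grad_eq_zero (I : Instance G p q μ Δ xs) {v : V} (hv : v ∈ supp xs) :
    grad G q μ Δ xs v = 0 :=
  I.optimum.grad_eq_zero I.μ_pos I.one_lt_q I.q_le_two (I.degree_pos v) (mem_supp.mp hv)

theorem supp_separates (I : Instance G p q μ Δ xs) : ∀ a ∈ supp xs, ∀ b ∉ supp xs, xs b ≤ xs a := by
  intro a _ b hb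
  have : xs b = 0 := by simpa [mem_supp] using hb
  rw [this]
  exact I.optimum.1 a

theorem supp_ne_univ (I : Instance G p q μ Δ xs) : supp xs ≠ Finset.univ := by
  intro h
  have h1 := volume_le_mass I.source_nonneg I.supp_separates fun a ha => (I.grad_eq_zero ha).le
  rw [h] at h1
  exact absurd h1 (not_le.mpr I.mass_lt_volume)

/-- At an excess node of height zero there is no outflow, so the gradient would be negative. -/
theorem supp_nonempty (I : Instance G p q μ Δ xs) : (supp xs).Nonempty := by
  obtain ⟨v, hv⟩ := I.exists_excess
  refine ⟨v, mem_supp.mpr fun h0 => ?_⟩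
  have h1 := I.grad_nonneg v
  have h2 : ∑ j ∈ G.neighborFinset v, flow q μ (xs v - xs j) ≤ 0 :=
    Finset.sum_nonpos fun j _ => flow_nonpos (by
      have : 0 ≤ xs j := I.optimum.1 j
      rw [h0]; linarith)
  unfold grad at h1
  linarith

/-- The support is neither empty nor everything, so some edge leaves it, and that edge carries
positive flow; this makes the bound strict. -/
theorem volume_supp_lt (I : Instance G p q μ Δ xs) :
    ∑ v ∈ supp xs, (G.degree v : ℝ) < mass Δ := by
  obtain ⟨i, hi, j, hj, hij⟩ := exists_boundary_edge I.connected I.supp_nonempty I.supp_ne_univ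
  have h1 := volume_add_flow_le_mass I.source_nonneg I.supp_separates
    (fun a ha => (I.grad_eq_zero ha).le) hi hj hij
  have h2 : xs j = 0 := by simpa [mem_supp] using hj
  have h3 : 0 < xs i := lt_of_le_of_ne (I.optimum.1 i) (Ne.symm (mem_supp.mp hi))
  have h4 : 0 < flow q μ (xs i - xs j) := flow_pos I.μ_pos (by linarith)
  linarith

theorem card_supp_lt (I : Instance G p q μ Δ xs) : ((supp xs).card : ℝ) < mass Δ := by
  refine lt_of_le_of_lt ?_ I.volume_supp_lt
  rw [Finset.card_eq_sum_ones, Nat.cast_sum]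
  exact Finset.sum_le_sum fun v _ => by exact_mod_cast I.degree_pos v

theorem degree_le_maxDegree {v : V} (hv : v ∈ supp xs) : G.degree v ≤ maxDegree G xs :=
  Finset.le_sup (f := fun v => G.degree v) hv

theorem one_le_maxDegree (I : Instance G p q μ Δ xs) : 1 ≤ maxDegree G xs := by
  obtain ⟨v, hv⟩ := I.supp_nonempty
  exact (I.degree_pos v).trans_le (degree_le_maxDegree hv)

theorem maxDegree_le_mass (I : Instance G p q μ Δ xs) : (maxDegree G xs : ℝ) ≤ mass Δ := by
  obtain ⟨v, hv, he⟩ := Finset.exists_mem_eq_sup _ I.supp_nonempty fun v => G.degree v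
  rw [maxDegree, he]
  exact (Finset.single_le_sum (f := fun v => (G.degree v : ℝ)) (fun _ _ => Nat.cast_nonneg _)
    hv).trans I.volume_supp_lt.le

theorem supp_subset_of_le (hx0 : 0 ≤ x) (hx : x ≤ xs) : supp x ⊆ supp xs := by
  intro v hv
  rw [mem_supp] at hv ⊢
  have h1 : 0 < x v := lt_of_le_of_ne (hx0 v) (Ne.symm hv)
  exact (h1.trans_le (hx v)).ne'

theorem below_optimum (I : Instance G p q μ Δ xs) : Below G q μ Δ xs xs :=
  ⟨I.optimum.1, le_rfl, fun _ hv => (I.grad_eq_zero (mem_supp.mpr hv.ne')).le⟩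

theorem below_zero (I : Instance G p q μ Δ xs) : Below G q μ Δ xs 0 :=
  ⟨le_rfl, I.optimum.1, fun _ hv => absurd hv (lt_irrefl _)⟩

/-- Cut at the level of `x i`: the upper set has positive heights and contains `i`, so its volume is
at least `1`, which supplies the `- 1`. -/
theorem flow_le (I : Instance G p q μ Δ xs) (hx : Below G q μ Δ xs x) {i j : V} (hij : G.Adj i j)
    (hlt : x j < x i) : flow q μ (x i - x j) ≤ mass Δ - 1 := by
  set A : Finset V := Finset.univ.filter fun v => x i ≤ x v
  have hi : i ∈ A := by simp [A]
  have hpos : 0 < x i := lt_of_le_of_lt (hx.nonneg j) hlt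
  have h1 := volume_add_flow_le_mass (A := A) I.source_nonneg
    (fun a ha b hb => by simp [A] at ha hb; linarith)
    (fun a ha => hx.grad_nonpos a (by simp [A] at ha; linarith)) hi
    (by simp [A]; exact hlt) hij
  have h2 : (G.degree i : ℝ) ≤ ∑ a ∈ A, (G.degree a : ℝ) :=
    Finset.single_le_sum (f := fun v => (G.degree v : ℝ)) (fun _ _ => Nat.cast_nonneg _) hi
  have h3 : (1 : ℝ) ≤ G.degree i := by exact_mod_cast I.degree_pos i
  linarith

theorem mem_region (I : Instance G p q μ Δ xs) (hx : Below G q μ Δ xs x) :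
    x ∈ region G μ Δ p xs := by
  refine ⟨supp_subset_of_le hx.nonneg hx.le, fun i j hij => ?_⟩
  refine sq_add_sq_le_of_flow_le I.μ_pos I.holder I.one_lt_mass I.μ_le ?_
  have hM := I.one_lt_mass
  rcases lt_trichotomy (x i) (x j) with h | h | h
  · rw [flow_sub_comm, abs_neg, abs_of_nonneg (flow_nonneg (by linarith))]
    exact I.flow_le hx hij.symm h
  · rw [h, sub_self, flow_zero, abs_zero]; linarith
  · rw [abs_of_nonneg (flow_nonneg (by linarith))]
    exact I.flow_le hx hij h

/-- The parameter is the edge curvature `m` on `region` divided by the Poincaré constant `n²`;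
strictness comes from `n < |Δ|`. -/
theorem exists_stronglyConvex (I : Instance G p q μ Δ xs) :
    ∃ γ : ℝ, 1 / ((p - 1) * mass Δ ^ p) < γ ∧ StronglyConvex G q μ Δ p xs γ := by
  have hM := I.one_lt_mass
  have hM0 : 0 < mass Δ := by linarith
  have hp := I.one_lt_p
  have hq := I.one_lt_q
  set n : ℝ := ((supp xs).card : ℝ)
  have hn : 0 < n := Nat.cast_pos.mpr (Finset.card_pos.mpr I.supp_nonempty)
  have hnM : n < mass Δ := I.card_supp_lt
  have hpq1 : (p - 1) * (q - 1) = 1 := by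
    have := I.holder.mul_eq_add; linarith
  set m : ℝ := (q - 1) * (mass Δ ^ (2 * p - 2)) ^ (q / 2 - 1)
  -- By `(p - 1)(q - 1) = 1` the exponent is `(p - 1)(q - 2) = 2 - p`.
  have hm : m = (q - 1) * mass Δ ^ (2 - p) := by
    simp only [m]
    rw [← Real.rpow_mul hM0.le]
    congr 2
    linear_combination hpq1
  have hm0 : 0 < m := by
    rw [hm]; exact mul_pos (by linarith) (Real.rpow_pos_of_pos hM0 _)
  refine ⟨m / n ^ 2, ?_, ?_⟩
  · have h1 : 1 / ((p - 1) * mass Δ ^ p) = m / mass Δ ^ 2 := by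
      have hMp : mass Δ ^ p ≠ 0 := (Real.rpow_pos_of_pos hM0 p).ne'
      have hp1 : p - 1 ≠ 0 := by linarith
      rw [hm, Real.rpow_sub hM0, Real.rpow_two, eq_div_iff (by positivity)]
      field_simp
      linarith
    rw [h1]
    exact div_lt_div_of_pos_left hm0 (by positivity) (by gcongr)
  · intro x hx y hy
    have h1 := Fmu_lower_bound (Δ := Δ) I.μ_pos hq I.q_le_two hx.2 hy.2
    have h2 := sum_sq_le_energy I.connected I.supp_ne_univ (h := fun v => y v - x v) (by
      intro v hv
      have h3 : x v = 0 := by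
        by_contra h; exact hv (hx.1 (mem_supp.mpr h))
      have h4 : y v = 0 := by
        by_contra h; exact hv (hy.1 (mem_supp.mpr h))
      simp [h3, h4])
    simp only [partialDeriv_Fmu I.μ_pos I.q_ne_zero]
    have h5 : m / n ^ 2 / 2 * ∑ i, (y i - x i) ^ 2
        ≤ m / 2 * energy G (fun i => y i - x i) := by
      calc _ ≤ m / n ^ 2 / 2 * (n ^ 2 * energy G (fun i => y i - x i)) :=
            mul_le_mul_of_nonneg_left h2 (by positivity)
        _ = _ := by field_simp
    linarith

theorem pos_step (I : Instance G p q μ Δ xs) {i : V} (hi : grad G q μ Δ x i < 0) :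
    0 < -(μ ^ (2 - q) / G.degree i * grad G q μ Δ x i) := by
  have h1 : (0 : ℝ) < G.degree i := by exact_mod_cast I.degree_pos i
  have h2 : 0 < μ ^ (2 - q) / G.degree i := div_pos (Real.rpow_pos_of_pos I.μ_pos _) h1
  nlinarith

theorem step_mul (I : Instance G p q μ Δ xs) (i : V) (g : ℝ) :
    G.degree i * μ ^ (q - 2) * (μ ^ (2 - q) / G.degree i * g) = g := by
  have h1 : (G.degree i : ℝ) ≠ 0 := by exact_mod_cast (I.degree_pos i).ne'
  have h2 : μ ^ (q - 2) * μ ^ (2 - q) = 1 := by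
    rw [← Real.rpow_add I.μ_pos]; simp
  field_simp
  linear_combination g * h2

theorem below_step (I : Instance G p q μ Δ xs) (hx : Below G q μ Δ xs x) {i : V}
    (hi : grad G q μ Δ x i < 0) : Below G q μ Δ xs (coordStep G q μ Δ x i) := by
  rw [coordStep_eq I.μ_pos I.q_ne_zero]
  have hs := I.pos_step hi
  set s := -(μ ^ (2 - q) / G.degree i * grad G q μ Δ x i) with hs_def
  -- The step times the coordinate smoothness is exactly `-grad`, so the gradient can at most climb
  -- back to zero.
  have hself : grad G q μ Δ (Function.update x i (x i + s)) i ≤ 0 := by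
    have h1 := grad_update_self_le (G := G) (q := q) (Δ := Δ) I.μ_pos I.q_le_two hs.le i x
    have h2 := I.step_mul i (grad G q μ Δ x i)
    rw [hs_def, mul_neg, h2] at h1
    linarith
  refine ⟨update_add_nonneg hx.nonneg (add_nonneg (hx.nonneg i) hs.le), ?_, ?_⟩
  · intro k
    by_cases hk : k = i
    · subst hk
      rw [Function.update_self]
      -- If `k` overshot the optimum while its neighbors stay below theirs, its outflow would be
      -- strictly larger than at `xs`, making the new gradient positive against `hself`.
      by_contra! hlt
      have hne : (G.neighborFinset k).Nonempty := by
        rw [← Finset.card_pos, SimpleGraph.card_neighborFinset_eq_degree]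
        exact I.degree_pos k
      have h1 : grad G q μ Δ xs k < grad G q μ Δ (Function.update x k (x k + s)) k := by
        unfold grad
        refine sub_lt_sub_right (Finset.sum_lt_sum_of_nonempty hne fun j hj =>
          flow_strictMono I.μ_pos I.one_lt_q ?_) _
        rw [SimpleGraph.mem_neighborFinset] at hj
        have := hx.le j
        simp [hj.ne']
        linarith
      have h2 := I.grad_nonneg k
      linarith
    · simpa [hk] using hx.le k
  · intro v hv
    by_cases hk : v = i
    · subst hk; exact hself
    · refine (grad_update_other_le I.μ_pos I.one_lt_q hs.le hk x).trans (hx.grad_nonpos v ?_)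
      simpa [hk] using hv

/-- The step strictly raises `i` and still stays below the optimum. -/
theorem mem_supp_of_grad_neg (I : Instance G p q μ Δ xs) (hx : Below G q μ Δ xs x) {i : V}
    (hi : grad G q μ Δ x i < 0) : i ∈ supp xs := by
  have h1 := (I.below_step hx hi).le i
  rw [coordStep_eq I.μ_pos I.q_ne_zero, Function.update_self] at h1
  have h2 := I.pos_step hi
  have h3 : 0 ≤ x i := hx.nonneg i
  exact mem_supp.mpr (by linarith)

theorem negSet_subset_supp (I : Instance G p q μ Δ xs) (hx : Below G q μ Δ xs x) :
    negSet G q μ Δ x ⊆ supp xs := fun _ hi =>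
  I.mem_supp_of_grad_neg hx ((mem_negSet I.μ_pos I.q_ne_zero).mp hi)

theorem gap_nonneg (I : Instance G p q μ Δ xs) (hx : Below G q μ Δ xs x) :
    0 ≤ Fmu G q μ Δ x - Fmu G q μ Δ xs := sub_nonneg.mpr (I.optimum.2 x hx.nonneg)

/-- One-sided Polyak–Łojasiewicz inequality: as `xs - x ≥ 0`, coordinates with nonnegative gradient
only help, and on the others one completes the square. -/
theorem gap_le (I : Instance G p q μ Δ xs) {γ : ℝ} (hγ : 0 < γ)
    (hsc : StronglyConvex G q μ Δ p xs γ) (hx : Below G q μ Δ xs x) :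
    Fmu G q μ Δ x - Fmu G q μ Δ xs
      ≤ 1 / (2 * γ) * ∑ i ∈ negSet G q μ Δ x, grad G q μ Δ x i ^ 2 := by
  have h1 := hsc x (I.mem_region hx) xs (I.mem_region I.below_optimum)
  simp only [partialDeriv_Fmu I.μ_pos I.q_ne_zero] at h1
  rw [add_assoc, Finset.mul_sum, ← Finset.sum_add_distrib] at h1
  have h2 : -(1 / (2 * γ) * ∑ i ∈ negSet G q μ Δ x, grad G q μ Δ x i ^ 2)
      ≤ ∑ i, (grad G q μ Δ x i * (xs i - x i) + γ / 2 * (xs i - x i) ^ 2) := by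
    rw [negSet_eq I.μ_pos I.q_ne_zero, Finset.sum_filter, Finset.mul_sum,
      ← Finset.sum_neg_distrib]
    refine Finset.sum_le_sum fun i _ => ?_
    have hle : 0 ≤ xs i - x i := sub_nonneg.mpr (hx.le i)
    split_ifs with h
    · have : grad G q μ Δ x i * (xs i - x i) + γ / 2 * (xs i - x i) ^ 2
          + 1 / (2 * γ) * grad G q μ Δ x i ^ 2
          = 1 / (2 * γ) * (grad G q μ Δ x i + γ * (xs i - x i)) ^ 2 := by
        field_simp; ring
      have h0 : 0 ≤ 1 / (2 * γ) * (grad G q μ Δ x i + γ * (xs i - x i)) ^ 2 := by positivity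
      linarith
    · have : 0 ≤ grad G q μ Δ x i * (xs i - x i) := mul_nonneg (not_lt.mp h) hle
      have : 0 ≤ γ / 2 * (xs i - x i) ^ 2 := by positivity
      linarith
  linarith

theorem Fmu_step_le (I : Instance G p q μ Δ xs) (x : V → ℝ) (i : V) :
    Fmu G q μ Δ (coordStep G q μ Δ x i)
      ≤ Fmu G q μ Δ x - μ ^ (2 - q) / (2 * G.degree i) * grad G q μ Δ x i ^ 2 := by
  rw [coordStep_eq I.μ_pos I.q_ne_zero]
  refine (Fmu_update_le I.μ_pos I.one_lt_q I.q_le_two x i _).trans ?_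
  have h := I.step_mul i (grad G q μ Δ x i)
  have h1 : (G.degree i : ℝ) ≠ 0 := by exact_mod_cast (I.degree_pos i).ne'
  have e : μ ^ (2 - q) / (2 * G.degree i) * grad G q μ Δ x i ^ 2
      = μ ^ (2 - q) / G.degree i * grad G q μ Δ x i * grad G q μ Δ x i / 2 := by
    field_simp
  rw [e]
  apply le_of_eq
  linear_combination (μ ^ (2 - q) / G.degree i * grad G q μ Δ x i) / 2 * h

/-- On average, one step contracts the gap to the optimum. -/
theorem sum_gap_step_le (I : Instance G p q μ Δ xs) {γ : ℝ} (hγ : 0 < γ)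
    (hsc : StronglyConvex G q μ Δ p xs γ) (hx : Below G q μ Δ xs x) :
    ∑ i ∈ negSet G q μ Δ x, (Fmu G q μ Δ (coordStep G q μ Δ x i) - Fmu G q μ Δ xs)
      ≤ (negSet G q μ Δ x).card
        * ((1 - γ * μ ^ (2 - q) / (mass Δ * maxDegree G xs))
          * (Fmu G q μ Δ x - Fmu G q μ Δ xs)) := by
  set N := negSet G q μ Δ x
  set d : ℝ := (maxDegree G xs : ℝ)
  have hd : 0 < d := by
    have : (1 : ℝ) ≤ d := Nat.one_le_cast.mpr I.one_le_maxDegree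
    linarith
  have hM : 0 < mass Δ := by linarith [I.one_lt_mass]
  have hμ2 : 0 < μ ^ (2 - q) := Real.rpow_pos_of_pos I.μ_pos _
  have hN : (N.card : ℝ) ≤ mass Δ :=
    (by exact_mod_cast Finset.card_le_card (I.negSet_subset_supp hx) :
      (N.card : ℝ) ≤ (supp xs).card).trans I.card_supp_lt.le
  set gap := Fmu G q μ Δ x - Fmu G q μ Δ xs
  have hgap : 0 ≤ gap := I.gap_nonneg hx
  have h1 : ∑ i ∈ N, (Fmu G q μ Δ (coordStep G q μ Δ x i) - Fmu G q μ Δ xs)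
      ≤ ∑ i ∈ N, (gap - μ ^ (2 - q) / (2 * d) * grad G q μ Δ x i ^ 2) := by
    refine Finset.sum_le_sum fun i hi => ?_
    have h2 := I.Fmu_step_le x i
    have h3 : (G.degree i : ℝ) ≤ d :=
      Nat.cast_le.mpr (degree_le_maxDegree (I.negSet_subset_supp hx hi))
    have h4 : (0 : ℝ) < G.degree i := by exact_mod_cast I.degree_pos i
    have h5 : μ ^ (2 - q) / (2 * d) * grad G q μ Δ x i ^ 2
        ≤ μ ^ (2 - q) / (2 * G.degree i) * grad G q μ Δ x i ^ 2 := by gcongr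
    simp only [gap]
    linarith
  have h1' : ∑ i ∈ N, (gap - μ ^ (2 - q) / (2 * d) * grad G q μ Δ x i ^ 2)
      = N.card * gap - μ ^ (2 - q) / (2 * d) * ∑ i ∈ N, grad G q μ Δ x i ^ 2 := by
    rw [Finset.sum_sub_distrib, Finset.sum_const, nsmul_eq_mul, ← Finset.mul_sum]
  rw [h1'] at h1
  have h6 := I.gap_le hγ hsc hx
  have h7 : γ * μ ^ (2 - q) / d * gap
      ≤ μ ^ (2 - q) / (2 * d) * ∑ i ∈ N, grad G q μ Δ x i ^ 2 := by
    calc γ * μ ^ (2 - q) / d * gap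
        ≤ γ * μ ^ (2 - q) / d * (1 / (2 * γ) * ∑ i ∈ N, grad G q μ Δ x i ^ 2) :=
          mul_le_mul_of_nonneg_left h6 (by positivity)
      _ = _ := by field_simp
  -- Uniform sampling divides the total decrease by `|N|`, which is less than `|Δ|`.
  have h8 : N.card * (γ * μ ^ (2 - q) / (mass Δ * d) * gap) ≤ γ * μ ^ (2 - q) / d * gap := by
    calc N.card * (γ * μ ^ (2 - q) / (mass Δ * d) * gap)
        ≤ mass Δ * (γ * μ ^ (2 - q) / (mass Δ * d) * gap) :=
          mul_le_mul_of_nonneg_right hN (by positivity)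
      _ = _ := by field_simp
  calc _ ≤ _ := h1
    _ ≤ _ := by rw [sub_mul, one_mul, mul_sub]; linarith

/-- At `0` the negative partial derivatives are `deg - Δ`, with squares summing to at most `|Δ|²`;
then `gap_le` applies with the explicit parameter. -/
theorem initial_gap_le (I : Instance G p q μ Δ xs) :
    Fmu G q μ Δ 0 - Fmu G q μ Δ xs ≤ (p - 1) * mass Δ ^ (p + 2) / 2 := by
  obtain ⟨γ, hγ, hsc⟩ := I.exists_stronglyConvex
  have hM : 0 < mass Δ := by linarith [I.one_lt_mass]
  have hp := I.one_lt_p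
  have hMp : 0 < mass Δ ^ p := Real.rpow_pos_of_pos hM p
  have hB : 0 < (p - 1) * mass Δ ^ p := mul_pos (by linarith) hMp
  have hγ0 : 0 < γ := lt_trans (by positivity) hγ
  have h1 := I.gap_le hγ0 hsc I.below_zero
  have h2 : ∑ i ∈ negSet G q μ Δ 0, grad G q μ Δ 0 i ^ 2 ≤ mass Δ ^ 2 := by
    calc ∑ i ∈ negSet G q μ Δ 0, grad G q μ Δ 0 i ^ 2
        ≤ ∑ i ∈ negSet G q μ Δ 0, Δ i * mass Δ := by
          refine Finset.sum_le_sum fun i hi => ?_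
          have h3 := (mem_negSet I.μ_pos I.q_ne_zero).mp hi
          have h4 := source_le_mass I.source_nonneg i
          have h5 : grad G q μ Δ 0 i = G.degree i - Δ i := by simp [grad]
          have h6 : (0 : ℝ) ≤ G.degree i := Nat.cast_nonneg _
          rw [h5] at h3 ⊢
          nlinarith [I.source_nonneg i]
      _ ≤ ∑ i, Δ i * mass Δ := Finset.sum_le_sum_of_subset_of_nonneg (Finset.subset_univ _)
          fun i _ _ => mul_nonneg (I.source_nonneg i) hM.le
      _ = mass Δ ^ 2 := by rw [← Finset.sum_mul, sq]; rfl
  have h3 : 1 / (2 * γ) ≤ (p - 1) * mass Δ ^ p / 2 := by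
    rw [div_lt_iff₀ hB] at hγ
    rw [div_le_div_iff₀ (by positivity) (by norm_num)]
    linarith
  calc _ ≤ _ := h1
    _ ≤ (p - 1) * mass Δ ^ p / 2 * mass Δ ^ 2 := by gcongr
    _ = _ := by rw [Real.rpow_add hM, Real.rpow_two]; ring

/-- No strong convexity parameter exceeds the smoothness of the objective. -/
theorem parameter_le (I : Instance G p q μ Δ xs) {γ : ℝ}
    (hsc : StronglyConvex G q μ Δ p xs γ) : γ ≤ maxDegree G xs * μ ^ (q - 2) := by
  obtain ⟨v, hv⟩ := I.supp_nonempty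
  have hμ := I.μ_pos
  have hM := I.one_lt_mass
  have hR1 : 1 < mass Δ ^ (2 * p - 2) := Real.one_lt_rpow hM (by linarith [I.one_lt_p])
  have hμ1 : μ < 1 := I.μ_le.trans_lt (by rw [div_lt_one (by linarith)]; exact hM)
  have hs0 : 0 < 1 - μ := by linarith
  -- Compare upper and lower parabola along one coordinate; height `1 - μ` is admissible because `(1
  -- - μ)² + μ² ≤ 1`.
  set y : V → ℝ := Function.update (0 : V → ℝ) v ((0 : V → ℝ) v + (1 - μ)) with hy
  have hmem : y ∈ region G μ Δ p xs := by
    refine ⟨fun k hk => ?_, fun i j _ => ?_⟩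
    · by_cases h : k = v
      · rwa [h]
      · rw [mem_supp] at hk
        exact absurd (by simp [hy, h]) hk
    · have h01 : ∀ k, 0 ≤ y k ∧ y k ≤ 1 - μ := by
        intro k
        by_cases h : k = v
        · subst h; simp [hy, hs0.le]
        · simp [hy, h, hs0.le]
      have hi := h01 i
      have hj := h01 j
      nlinarith [hi.1, hi.2, hj.1, hj.2]
  have h1 := hsc 0 (I.mem_region I.below_zero) y hmem
  have h2 := Fmu_update_le (G := G) (Δ := Δ) hμ I.one_lt_q I.q_le_two 0 v (1 - μ)
  simp only [partialDeriv_Fmu I.μ_pos I.q_ne_zero] at h1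
  rw [sum_mul_update_sub] at h1
  have h3 : ∑ i, (y i - (0 : V → ℝ) i) ^ 2 = (1 - μ) ^ 2 := by
    rw [Finset.sum_eq_single v (fun k _ hk => by simp [hy, hk]) (by simp)]
    simp [hy]
  rw [h3] at h1
  have h4 : γ / 2 * (1 - μ) ^ 2 ≤ G.degree v * μ ^ (q - 2) / 2 * (1 - μ) ^ 2 := by linarith
  have h5 := le_of_mul_le_mul_right h4 (by positivity)
  have h6 : (G.degree v : ℝ) ≤ maxDegree G xs := by exact_mod_cast degree_le_maxDegree hv
  have h7 : (G.degree v : ℝ) * μ ^ (q - 2) ≤ maxDegree G xs * μ ^ (q - 2) := by gcongr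
  linarith

theorem objective_le (I : Instance G p q μ Δ xs) (hx : Below G q μ Δ xs x) {y : V → ℝ}
    (hy : 0 ≤ y) : F G q Δ x
      ≤ Fmu G q μ Δ x - Fmu G q μ Δ xs + (F G q Δ y + μ ^ q * mass Δ) := by
  have h1 := edgeSum_diff_le (G := G) (Δ := Δ) (x := x) I.μ_pos I.one_lt_q I.q_le_two
    (S := supp xs) (fun v hv => by
      by_contra h
      exact hv (supp_subset_of_le hx.nonneg hx.le (mem_supp.mpr h))) y
  have h2 := I.optimum.2 y hy
  have h3 : μ ^ q * ∑ v ∈ supp xs, (G.degree v : ℝ) ≤ μ ^ q * mass Δ :=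
    mul_le_mul_of_nonneg_left I.volume_supp_lt.le (Real.rpow_nonneg I.μ_pos.le q)
  linarith

end Instance

/-! ### Expectations under laws of finite support. -/

section Expectation

variable {α β : Type}

theorem expect_eq_sum (P : PMF α) (f : α → ℝ) {s : Finset α} (hs : P.support ⊆ s) :
    expect P f = ∑ a ∈ s, (P a).toReal * f a := by
  refine tsum_eq_sum fun a ha => ?_
  have : P a = 0 := by
    by_contra h
    exact ha (by simpa using hs ((P.mem_support_iff a).mpr h))
  simp [this]

theorem sum_toReal_eq_one (P : PMF α) {s : Finset α} (hs : P.support ⊆ s) :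
    ∑ a ∈ s, (P a).toReal = 1 := by
  rw [← ENNReal.toReal_sum fun a _ => P.apply_ne_top a, ← ENNReal.toReal_one, ← P.tsum_coe]
  congr 1
  refine (tsum_eq_sum fun a ha => ?_).symm
  by_contra h
  exact ha (by simpa using hs ((P.mem_support_iff a).mpr h))

theorem expect_mono {P : PMF α} (hP : P.support.Finite) {f g : α → ℝ}
    (hfg : ∀ a ∈ P.support, f a ≤ g a) : expect P f ≤ expect P g := by
  rw [expect_eq_sum P f (s := hP.toFinset) (by simp), expect_eq_sum P g (s := hP.toFinset) (by simp)]
  exact Finset.sum_le_sum fun a ha =>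
    mul_le_mul_of_nonneg_left (hfg a (by simpa using ha)) ENNReal.toReal_nonneg

theorem expect_add_const {P : PMF α} (hP : P.support.Finite) (f : α → ℝ) (c : ℝ) :
    expect P (fun a => f a + c) = expect P f + c := by
  have hs : P.support ⊆ hP.toFinset := by simp
  rw [expect_eq_sum P _ hs, expect_eq_sum P f hs]
  simp only [mul_add, Finset.sum_add_distrib, ← Finset.sum_mul]
  rw [sum_toReal_eq_one P hs, one_mul]

theorem expect_const_mul (P : PMF α) (f : α → ℝ) (c : ℝ) :
    expect P (fun a => c * f a) = c * expect P f := by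
  rw [expect, expect, ← tsum_mul_left]
  exact tsum_congr fun a => by ring

theorem expect_pure (a : α) (f : α → ℝ) : expect (PMF.pure a) f = f a := by
  rw [expect_eq_sum (PMF.pure a) f (s := {a}) (by simp)]
  simp

theorem expect_bind {P : PMF α} (hP : P.support.Finite) {h : α → PMF β}
    (hh : ∀ a ∈ P.support, (h a).support.Finite) (f : β → ℝ) :
    expect (P.bind h) f = expect P fun a => expect (h a) f := by
  classical
  have hs : P.support ⊆ hP.toFinset := by simp
  have hfin : (P.bind h).support.Finite := by
    rw [PMF.support_bind]
    exact hP.biUnion hh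
  have hT : ∀ a ∈ P.support, (h a).support ⊆ hfin.toFinset := by
    intro a ha
    rw [Set.Finite.coe_toFinset, PMF.support_bind]
    exact Set.subset_biUnion_of_mem (u := fun a => (h a).support) ha
  rw [expect_eq_sum _ f (s := hfin.toFinset) (by simp), expect_eq_sum P _ hs]
  have h1 : ∀ b, ((P.bind h) b).toReal = ∑ a ∈ hP.toFinset, (P a).toReal * (h a b).toReal := by
    intro b
    rw [PMF.bind_apply, tsum_eq_sum (s := hP.toFinset), ENNReal.toReal_sum]
    · simp only [ENNReal.toReal_mul]
    · exact fun a _ => ENNReal.mul_ne_top (P.apply_ne_top a) ((h a).apply_ne_top b)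
    · intro a ha
      have : P a = 0 := by
        by_contra hne
        exact ha (by simpa using hne)
      simp [this]
  simp only [h1, Finset.sum_mul]
  rw [Finset.sum_comm]
  refine Finset.sum_congr rfl fun a ha => ?_
  rw [expect_eq_sum (h a) f (hT a (by simpa using ha)), Finset.mul_sum]
  exact Finset.sum_congr rfl fun b _ => by ring

theorem expect_uniform_map {s : Finset α} (hs : s.Nonempty) (g : α → β) (f : β → ℝ) :
    expect ((PMF.uniformOfFinset s hs).map g) f = (∑ i ∈ s, f (g i)) / s.card := by
  have hsup : (PMF.uniformOfFinset s hs).support ⊆ s := by simp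
  rw [← PMF.bind_pure_comp, expect_bind (s.finite_toSet.subset hsup) (fun a _ => by simp),
    expect_eq_sum _ _ hsup, Finset.sum_div]
  refine Finset.sum_congr rfl fun i hi => ?_
  rw [Function.comp_apply, expect_pure, PMF.uniformOfFinset_apply_of_mem hs hi]
  simp
  ring

end Expectation

/-! ### Expected convergence of the iterates. -/

section Law

variable {V : Type} [Fintype V] [DecidableEq V] {G : SimpleGraph V} [DecidableRel G.Adj]
  {p q μ : ℝ} {Δ xs : V → ℝ}

/-- The transition law of the coordinate method. -/
noncomputable def transition (G : SimpleGraph V) [DecidableRel G.Adj] (q μ : ℝ) (Δ x : V → ℝ) :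
    PMF (V → ℝ) :=
  if h : (negSet G q μ Δ x).Nonempty then
    (PMF.uniformOfFinset (negSet G q μ Δ x) h).map (coordStep G q μ Δ x)
  else PMF.pure x

theorem iterate_succ (k : ℕ) :
    iterate G q μ Δ (k + 1) = (iterate G q μ Δ k).bind (transition G q μ Δ) := rfl

theorem transition_support_finite (x : V → ℝ) : (transition G q μ Δ x).support.Finite := by
  unfold transition
  split_ifs with h
  · rw [PMF.support_map, PMF.support_uniformOfFinset]
    exact (negSet G q μ Δ x).finite_toSet.image _
  · simp

theorem iterate_support_finite (k : ℕ) : (iterate G q μ Δ k).support.Finite := by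
  induction k with
  | zero => simp [iterate]
  | succ k ih =>
    rw [iterate_succ, PMF.support_bind]
    exact ih.biUnion fun x _ => transition_support_finite x

namespace Instance

theorem below_transition (I : Instance G p q μ Δ xs) {x : V → ℝ} (hx : Below G q μ Δ xs x) :
    ∀ y ∈ (transition G q μ Δ x).support, Below G q μ Δ xs y := by
  intro y hy
  unfold transition at hy
  split_ifs at hy with h
  · rw [PMF.support_map, PMF.support_uniformOfFinset] at hy
    obtain ⟨i, hi, rfl⟩ := hy
    exact I.below_step hx ((mem_negSet I.μ_pos I.q_ne_zero).mp hi)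
  · rw [PMF.support_pure, Set.mem_singleton_iff] at hy
    exact hy ▸ hx

theorem below_iterate (I : Instance G p q μ Δ xs) (k : ℕ) :
    ∀ x ∈ (iterate G q μ Δ k).support, Below G q μ Δ xs x := by
  induction k with
  | zero =>
    intro x hx
    simp [iterate] at hx
    exact hx ▸ I.below_zero
  | succ k ih =>
    intro y hy
    rw [iterate_succ, PMF.mem_support_bind_iff] at hy
    obtain ⟨x, hx, hxy⟩ := hy
    exact I.below_transition (ih x hx) y hxy

theorem expect_transition_gap_le (I : Instance G p q μ Δ xs) {γ : ℝ} (hγ : 0 < γ)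
    (hsc : StronglyConvex G q μ Δ p xs γ) {x : V → ℝ} (hx : Below G q μ Δ xs x) :
    expect (transition G q μ Δ x) (fun y => Fmu G q μ Δ y - Fmu G q μ Δ xs)
      ≤ (1 - γ * μ ^ (2 - q) / (mass Δ * maxDegree G xs))
          * (Fmu G q μ Δ x - Fmu G q μ Δ xs) := by
  unfold transition
  split_ifs with h
  · rw [expect_uniform_map, div_le_iff₀ (Nat.cast_pos.mpr h.card_pos), mul_comm _ (Nat.cast _)]
    exact I.sum_gap_step_le hγ hsc hx
  -- With no negative partial derivative the gap is zero: the method stops only at an optimum.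
  · have h1 := I.gap_le hγ hsc hx
    rw [Finset.not_nonempty_iff_eq_empty.mp h, Finset.sum_empty, mul_zero] at h1
    have h2 := le_antisymm h1 (I.gap_nonneg hx)
    rw [expect_pure, h2, mul_zero]

theorem maxDegree_pos (I : Instance G p q μ Δ xs) : (0 : ℝ) < maxDegree G xs :=
  Nat.cast_pos.mpr I.one_le_maxDegree

theorem rate_le_one (I : Instance G p q μ Δ xs) {γ : ℝ}
    (hsc : StronglyConvex G q μ Δ p xs γ) :
    γ * μ ^ (2 - q) / (mass Δ * maxDegree G xs) ≤ 1 := by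
  have hM := I.one_lt_mass
  have hd := I.maxDegree_pos
  have hμ2 : 0 < μ ^ (2 - q) := Real.rpow_pos_of_pos I.μ_pos _
  have hinv : μ ^ (q - 2) * μ ^ (2 - q) = 1 := by
    rw [← Real.rpow_add I.μ_pos]; simp
  rw [div_le_one (by positivity)]
  calc γ * μ ^ (2 - q) ≤ maxDegree G xs * μ ^ (q - 2) * μ ^ (2 - q) :=
        mul_le_mul_of_nonneg_right (I.parameter_le hsc) hμ2.le
    _ = 1 * maxDegree G xs := by rw [mul_assoc, hinv]; ring
    _ ≤ mass Δ * maxDegree G xs := by gcongr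

theorem expect_gap_le (I : Instance G p q μ Δ xs) {γ : ℝ} (hγ : 0 < γ)
    (hsc : StronglyConvex G q μ Δ p xs γ) (k : ℕ) :
    expect (iterate G q μ Δ k) (fun y => Fmu G q μ Δ y - Fmu G q μ Δ xs)
      ≤ (1 - γ * μ ^ (2 - q) / (mass Δ * maxDegree G xs)) ^ k
          * (Fmu G q μ Δ 0 - Fmu G q μ Δ xs) := by
  induction k with
  | zero => simp [iterate, expect_pure]
  | succ k ih =>
    rw [iterate_succ, expect_bind (iterate_support_finite k)
      fun x _ => transition_support_finite x]
    refine (expect_mono (iterate_support_finite k) fun x hx =>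
      I.expect_transition_gap_le hγ hsc (I.below_iterate k x hx)).trans ?_
    rw [expect_const_mul, pow_succ']
    have := I.rate_le_one hsc
    rw [mul_assoc]
    exact mul_le_mul_of_nonneg_left ih (by linarith)

theorem expect_objective_le (I : Instance G p q μ Δ xs) {γ : ℝ} (hγ : 0 < γ)
    (hsc : StronglyConvex G q μ Δ p xs γ) (k : ℕ) {y : V → ℝ} (hy : 0 ≤ y) :
    expect (iterate G q μ Δ k) (F G q Δ)
      ≤ (1 - γ * μ ^ (2 - q) / (mass Δ * maxDegree G xs)) ^ k
          * (Fmu G q μ Δ 0 - Fmu G q μ Δ xs) + (F G q Δ y + μ ^ q * mass Δ) := by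
  refine (expect_mono (iterate_support_finite k) fun x hx =>
    I.objective_le (I.below_iterate k x hx) hy).trans ?_
  rw [expect_add_const (iterate_support_finite k)
    fun x => Fmu G q μ Δ x - Fmu G q μ Δ xs]
  have := I.expect_gap_le hγ hsc k
  linarith

end Instance

end Law

/-! ### Correctness and cost of the program. -/

section Program

open Timed

@[simp] theorem Timed.val_bind {α β : Type} (m : Timed α) (f : α → Timed β) :
    (m >>= f).val = (f m.val).val := rfl

@[simp] theorem Timed.time_bind {α β : Type} (m : Timed α) (f : α → Timed β) :
    (m >>= f).time = m.time + (f m.val).time := rfl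

@[simp] theorem Timed.val_pure {α : Type} (a : α) : (pure a : Timed α).val = a := rfl

@[simp] theorem Timed.time_pure {α : Type} (a : α) : (pure a : Timed α).time = 0 := rfl

@[simp] theorem Timed.val_tick {α : Type} (a : α) : (tick a).val = a := rfl

@[simp] theorem Timed.time_tick {α : Type} (a : α) : (tick a).time = 1 := rfl

variable {V : Type} [Fintype V] [DecidableEq V] {G : SimpleGraph V} [DecidableRel G.Adj]
  {p q μ : ℝ} {Δ xs : V → ℝ}

@[simp] theorem computeFlow_val (a b : ℝ) : (computeFlow q μ a b).val = flow q μ (a - b) := by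
  simp [computeFlow, flow, sq]

@[simp] theorem computeFlow_time (a b : ℝ) : (computeFlow q μ a b).time = 8 := rfl

@[simp] theorem computeMass_val (v : V) (s : Memory V) :
    (computeMass Δ v s).val = Δ v + s.inflow v := rfl

@[simp] theorem computeMass_time (v : V) (s : Memory V) : (computeMass Δ v s).time = 3 := rfl

theorem refresh_val (v : V) (s : Memory V) : (refresh G Δ v s).val
    = { s with active := if (G.degree v : ℝ) < Δ v + s.inflow v then insert v s.active
                         else s.active.erase v } := by
  by_cases h : (G.degree v : ℝ) < Δ v + s.inflow v <;> simp [refresh, h]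

@[simp] theorem refresh_time (v : V) (s : Memory V) : (refresh G Δ v s).time = 6 := by
  by_cases h : (G.degree v : ℝ) < Δ v + s.inflow v <;> simp [refresh, h]

@[simp] theorem refresh_height (v : V) (s : Memory V) :
    (refresh G Δ v s).val.height = s.height := by rw [refresh_val]

@[simp] theorem refresh_inflow (v : V) (s : Memory V) :
    (refresh G Δ v s).val.inflow = s.inflow := by rw [refresh_val]

theorem mem_refresh_active (v u : V) (s : Memory V) : u ∈ (refresh G Δ v s).val.active ↔
    if u = v then (G.degree v : ℝ) < Δ v + s.inflow v else u ∈ s.active := by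
  rw [refresh_val]
  by_cases h : (G.degree v : ℝ) < Δ v + s.inflow v <;> by_cases hu : u = v <;> simp [h, hu]

/-- The change of the flow along the edge from `i` to `j` as the height of `i` moves from
`a` to `b`. -/
noncomputable def flowChange (q μ : ℝ) (x : V → ℝ) (a b : ℝ) (j : V) : ℝ :=
  flow q μ (b - x j) - flow q μ (a - x j)

theorem updateEdge_val (i : V) (a b : ℝ) (s : Memory V) {j : V} (hj : j ≠ i) :
    (updateEdge G q μ Δ i a b s j).val = (refresh G Δ j
      ⟨s.height, Function.update
          (Function.update s.inflow j (s.inflow j + flowChange q μ s.height a b j))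
          i (s.inflow i - flowChange q μ s.height a b j), s.active⟩).val := by
  simp [updateEdge, flowChange, hj.symm]

theorem updateEdge_time (i : V) (a b : ℝ) (s : Memory V) (j : V) :
    (updateEdge G q μ Δ i a b s j).time = 31 := by
  simp [updateEdge]

/-- Each neighbor is visited once and later visits leave its inflow alone, so the activity test made
at that visit remains valid. The inflow of `i` changes throughout, so its activity is left to a
later `refresh`. -/
theorem updateEdges_spec (i : V) (a b : ℝ) (l : List V) (hl : l.Nodup) (hi : i ∉ l)
    (s : Memory V) :
    let r := l.foldlM (updateEdge G q μ Δ i a b) s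
    r.val.height = s.height ∧
    (∀ v, v ≠ i → r.val.inflow v
      = s.inflow v + if v ∈ l then flowChange q μ s.height a b v else 0) ∧
    r.val.inflow i = s.inflow i - (l.map (flowChange q μ s.height a b)).sum ∧
    (∀ v, v ∈ r.val.active ↔
      if v ∈ l then (G.degree v : ℝ) < Δ v + r.val.inflow v else v ∈ s.active) ∧
    r.time = 31 * l.length := by
  induction l generalizing s with
  | nil => simp
  | cons j l ih =>
    rw [List.nodup_cons] at hl
    rw [List.mem_cons, not_or] at hi
    have hji : j ≠ i := Ne.symm hi.1
    obtain ⟨h1, h2, h3, h4, h5⟩ := ih hl.2 hi.2 (updateEdge G q μ Δ i a b s j).val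
    have e := updateEdge_val (G := G) (q := q) (μ := μ) (Δ := Δ) i a b s hji
    have eh : (updateEdge G q μ Δ i a b s j).val.height = s.height := by rw [e]; simp
    have ein : (updateEdge G q μ Δ i a b s j).val.inflow = Function.update
          (Function.update s.inflow j (s.inflow j + flowChange q μ s.height a b j))
          i (s.inflow i - flowChange q μ s.height a b j) := by rw [e]; simp
    rw [eh] at h1 h2 h3
    rw [ein] at h2 h3
    have hjr : (l.foldlM (updateEdge G q μ Δ i a b)
        (updateEdge G q μ Δ i a b s j).val).val.inflow j
        = s.inflow j + flowChange q μ s.height a b j := by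
      rw [h2 j hji]; simp [hji, hl.1]
    simp only [List.foldlM_cons, Timed.val_bind, Timed.time_bind]
    refine ⟨h1, ?_, ?_, ?_, ?_⟩
    · intro v hv
      rw [h2 v hv]
      by_cases hvj : v = j
      · subst hvj; simp [hv, hl.1]
      · simp [hv, hvj]
    · rw [h3, List.map_cons, List.sum_cons, Function.update_self]; ring
    · intro v
      rw [h4 v]
      by_cases hvj : v = j
      · subst hvj
        rw [if_neg hl.1, if_pos (by simp), hjr, e, mem_refresh_active]
        simp [hji]
      · rw [e]
        simp only [mem_refresh_active, List.mem_cons, hvj, false_or, if_false]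
    · rw [h5, updateEdge_time, List.length_cons]; ring

theorem inspect_spec (l : List V) (s : Memory V) :
    let r := l.foldlM (fun s v => do
      let v ← tick v
      refresh G Δ v s) s
    r.val.height = s.height ∧ r.val.inflow = s.inflow ∧
    (∀ v, v ∈ r.val.active ↔
      if v ∈ l then (G.degree v : ℝ) < Δ v + s.inflow v else v ∈ s.active) ∧
    r.time = 7 * l.length := by
  induction l generalizing s with
  | nil => simp
  | cons j l ih =>
    obtain ⟨h1, h2, h3, h4⟩ := ih (refresh G Δ j s).val
    simp only [List.foldlM_cons, Timed.val_bind, Timed.time_bind, Timed.val_tick, Timed.time_tick]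
    refine ⟨by rw [h1]; simp, by rw [h2]; simp, ?_, ?_⟩
    · intro v
      rw [h3 v, refresh_inflow, mem_refresh_active]
      by_cases hvj : v = j
      · subst hvj; simp
      · simp [hvj]
    · rw [h4, refresh_time, List.length_cons]; ring

/-- The memory describes the flow that is induced by the heights, and its active nodes. -/
structure Consistent (G : SimpleGraph V) [DecidableRel G.Adj] (q μ : ℝ) (Δ : V → ℝ)
    (s : Memory V) : Prop where
  inflow_eq : ∀ v, s.inflow v = ∑ j ∈ G.neighborFinset v, flow q μ (s.height j - s.height v)
  mem_active : ∀ v, v ∈ s.active ↔ (G.degree v : ℝ) < Δ v + s.inflow v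

theorem Consistent.grad_eq {s : Memory V} (hs : Consistent G q μ Δ s) (v : V) :
    grad G q μ Δ s.height v = G.degree v - (Δ v + s.inflow v) := by
  rw [hs.inflow_eq, grad]
  simp only [flow_sub_comm (s.height v) _, Finset.sum_neg_distrib]
  ring

theorem Consistent.active_eq (hμ : 0 < μ) (hq : q ≠ 0) {s : Memory V}
    (hs : Consistent G q μ Δ s) : s.active = negSet G q μ Δ s.height := by
  ext v
  rw [hs.mem_active, mem_negSet hμ hq, hs.grad_eq, sub_neg]

theorem start_height : (start G Δ).val.height = 0 := by
  obtain ⟨h1, -⟩ := inspect_spec (G := G) (Δ := Δ) (supp Δ).toList ⟨0, 0, ∅⟩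
  exact h1

theorem start_time : (start G Δ).time = 7 * (supp Δ).card + 2 := by
  obtain ⟨-, -, -, h4⟩ := inspect_spec (G := G) (Δ := Δ) (supp Δ).toList ⟨0, 0, ∅⟩
  rw [Finset.length_toList] at h4
  simp only [start, Timed.time_bind, Timed.val_tick, Timed.time_tick]
  rw [h4]; ring

theorem start_consistent : Consistent G q μ Δ (start G Δ).val := by
  obtain ⟨h1, h2, h3, -⟩ := inspect_spec (G := G) (Δ := Δ) (supp Δ).toList ⟨0, 0, ∅⟩
  constructor
  · intro v
    rw [start_height]
    have e : (start G Δ).val.inflow v = 0 := congrFun h2 v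
    simp [e]
  · intro v
    refine (h3 v).trans ?_
    have e : (start G Δ).val.inflow v = 0 := congrFun h2 v
    rw [e]
    by_cases hv : v ∈ supp Δ
    · simp [hv]
    -- A node never inspected has no source, so it cannot exceed its degree.
    · have : Δ v = 0 := by simpa [mem_supp] using hv
      simp [hv, this]

/-- Only flows on edges at `i` change, so correcting the inflow of `i` and its neighbors restores
consistency. -/
theorem push_spec {s : Memory V} (hs : Consistent G q μ Δ s) (i : V) :
    (push G q μ Δ i s).val.height = Function.update s.height i
        (s.height i - μ ^ (2 - q) / G.degree i * grad G q μ Δ s.height i) ∧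
      Consistent G q μ Δ (push G q μ Δ i s).val ∧
      (push G q μ Δ i s).time = 31 * G.degree i + 18 := by
  set b := s.height i - μ ^ (2 - q) / G.degree i * (G.degree i - (Δ i + s.inflow i)) with hb
  set s' : Memory V := { s with height := Function.update s.height i b }
  have hmem : ∀ v, v ∈ (G.neighborFinset i).toList ↔ G.Adj i v := by simp
  obtain ⟨h1, h2, h3, h4, h5⟩ := updateEdges_spec (G := G) (q := q) (μ := μ) (Δ := Δ) i
    (s.height i) b (G.neighborFinset i).toList (Finset.nodup_toList _) (by simp) s'
  set r := (G.neighborFinset i).toList.foldlM (updateEdge G q μ Δ i (s.height i) b) s' with hr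
  have hval : (push G q μ Δ i s).val = (refresh G Δ i r.val).val := rfl
  have hheight : (push G q μ Δ i s).val.height = Function.update s.height i b := by
    rw [hval, refresh_height, h1]
  have hchange : ∀ v, G.Adj i v → flowChange q μ s'.height (s.height i) b v
      = flow q μ (b - s.height v) - flow q μ (s.height i - s.height v) := by
    intro v hv
    simp [flowChange, s', hv.ne']
  refine ⟨?_, ⟨?_, ?_⟩, ?_⟩
  · rw [hheight, hb, hs.grad_eq]
  · intro v
    rw [hheight, hval, refresh_inflow]
    by_cases hv : v = i
    · subst hv
      rw [h3, Finset.sum_map_toList]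
      change s.inflow v - _ = _
      rw [hs.inflow_eq v, ← Finset.sum_sub_distrib]
      refine Finset.sum_congr rfl fun j hj => ?_
      rw [SimpleGraph.mem_neighborFinset] at hj
      rw [hchange j hj, Function.update_self, Function.update_of_ne hj.ne',
        flow_sub_comm b (s.height j), flow_sub_comm (s.height v) (s.height j)]
      ring
    · rw [h2 v hv]
      change s.inflow v + _ = _
      rw [hs.inflow_eq v, Function.update_of_ne hv]
      by_cases hadj : G.Adj i v
      · rw [if_pos ((hmem v).mpr hadj), hchange v hadj]
        have hi : i ∈ G.neighborFinset v := by simpa using hadj.symm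
        rw [← Finset.add_sum_erase _ _ hi, ← Finset.add_sum_erase _ _ hi, Function.update_self]
        have : ∑ j ∈ (G.neighborFinset v).erase i,
            flow q μ (Function.update s.height i b j - s.height v)
            = ∑ j ∈ (G.neighborFinset v).erase i, flow q μ (s.height j - s.height v) :=
          Finset.sum_congr rfl fun j hj => by
            rw [Function.update_of_ne (Finset.ne_of_mem_erase hj)]
        rw [this]
        ring
      · rw [if_neg (by rwa [hmem]), add_zero]
        refine Finset.sum_congr rfl fun j hj => ?_
        rw [SimpleGraph.mem_neighborFinset] at hj
        rw [Function.update_of_ne]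
        rintro rfl
        exact hadj hj.symm
  · intro v
    rw [hval, mem_refresh_active, refresh_inflow]
    by_cases hv : v = i
    · subst hv; simp
    · rw [if_neg hv, h4 v]
      by_cases hadj : G.Adj i v
      · rw [if_pos ((hmem v).mpr hadj)]
      · rw [if_neg (by rwa [hmem]), h2 v hv, if_neg (by rwa [hmem]), add_zero]
        exact hs.mem_active v
  · rw [Finset.length_toList, SimpleGraph.card_neighborFinset_eq_degree] at h5
    have : (push G q μ Δ i s).time = 12 + r.time + 6 := by
      simp only [push, Timed.time_bind, Timed.time_tick, computeMass_time, refresh_time,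
        Timed.val_tick, computeMass_val]
      rw [hr]
      ring
    rw [this, h5]; ring

theorem pmf_bind_congr {α β : Type} {P : PMF α} {f g : α → PMF β}
    (h : ∀ a ∈ P.support, f a = g a) : P.bind f = P.bind g := by
  ext b
  rw [PMF.bind_apply, PMF.bind_apply]
  refine tsum_congr fun a => ?_
  by_cases ha : P a = 0
  · simp [ha]
  · rw [h a ((P.mem_support_iff a).mpr ha)]

theorem uniformOfFinset_congr {α : Type} {s t : Finset α} (h : s = t) (hs : s.Nonempty)
    (ht : t.Nonempty) : PMF.uniformOfFinset s hs = PMF.uniformOfFinset t ht := by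
  subst h; rfl

theorem iteration_map_height (hμ : 0 < μ) (hq : q ≠ 0) {r : Timed (Memory V)}
    (hr : Consistent G q μ Δ r.val) :
    (iteration G q μ Δ r).map (fun r => r.val.height) = transition G q μ Δ r.val.height := by
  have ha := hr.active_eq hμ hq
  unfold iteration transition
  by_cases h : r.val.active.Nonempty
  · have h' : (negSet G q μ Δ r.val.height).Nonempty := ha ▸ h
    rw [dif_pos h, dif_pos h', PMF.map_comp, uniformOfFinset_congr ha h h']
    congr 1
    funext i
    refine (push_spec hr i).1.trans ?_
    rw [coordStep, partialDeriv_Fmu hμ hq]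
  · have h' : ¬(negSet G q μ Δ r.val.height).Nonempty := ha ▸ h
    rw [dif_neg h, dif_neg h', PMF.pure_map]

theorem mem_iteration_support {r r' : Timed (Memory V)}
    (hr : Consistent G q μ Δ r.val) (h : r' ∈ (iteration G q μ Δ r).support) :
    Consistent G q μ Δ r'.val ∧
      (r' = r ∨ ∃ i ∈ r.val.active, r'.time = r.time + (31 * G.degree i + 20)) := by
  unfold iteration at h
  split_ifs at h with ha
  · rw [PMF.support_map, PMF.support_uniformOfFinset] at h
    obtain ⟨i, hi, rfl⟩ := h
    obtain ⟨-, h2, h3⟩ := push_spec hr i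
    refine ⟨h2, Or.inr ⟨i, hi, ?_⟩⟩
    simp only [Timed.time_bind, Timed.time_tick, Timed.val_tick, h3]
    ring
  · rw [PMF.support_pure, Set.mem_singleton_iff] at h
    subst h
    exact ⟨hr, Or.inl rfl⟩

theorem run_consistent (k : ℕ) : ∀ r ∈ (run G q μ Δ k).support, Consistent G q μ Δ r.val := by
  induction k with
  | zero =>
    intro r hr
    simp [run] at hr
    exact hr ▸ start_consistent
  | succ k ih =>
    intro r' hr'
    rw [run, PMF.mem_support_bind_iff] at hr'
    obtain ⟨r, hr, hrr⟩ := hr'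
    exact (mem_iteration_support (ih r hr) hrr).1

theorem run_map_height (hμ : 0 < μ) (hq : q ≠ 0) (k : ℕ) :
    (run G q μ Δ k).map (fun r => r.val.height) = iterate G q μ Δ k := by
  induction k with
  | zero => rw [run, PMF.pure_map, start_height]; rfl
  | succ k ih =>
    rw [run, PMF.map_bind, iterate_succ, ← ih, PMF.bind_map]
    exact pmf_bind_congr fun r hr => iteration_map_height hμ hq (run_consistent k r hr)

/-- An iteration costs `31 deg(i) + 20` (`push` plus sampling and emptiness test), at most `51 d̄`
as `i` lies in the optimal support and `d̄ ≥ 1`. -/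
theorem Instance.run_time_le (I : Instance G p q μ Δ xs) (k : ℕ) :
    ∀ r ∈ (run G q μ Δ k).support,
      r.time ≤ 7 * (supp Δ).card + 2 + k * (51 * maxDegree G xs) := by
  induction k with
  | zero =>
    intro r hr
    simp [run] at hr
    rw [hr, start_time]; simp
  | succ k ih =>
    intro r' hr'
    rw [run, PMF.mem_support_bind_iff] at hr'
    obtain ⟨r, hr, hrr⟩ := hr'
    have hc := run_consistent k r hr
    have h1 := ih r hr
    have hx : r.val.height ∈ (iterate G q μ Δ k).support := by
      rw [← run_map_height I.μ_pos I.q_ne_zero, PMF.support_map]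
      exact ⟨r, hr, rfl⟩
    rw [add_mul, one_mul]
    rcases (mem_iteration_support hc hrr).2 with rfl | ⟨i, hi, ht⟩
    · omega
    · rw [hc.active_eq I.μ_pos I.q_ne_zero] at hi
      have h2 := Instance.degree_le_maxDegree (G := G)
        (I.negSet_subset_supp (I.below_iterate k _ hx) hi)
      have h3 := I.one_le_maxDegree
      omega

end Program

/-! ### Choice of the constants and assembly. -/

theorem scale_le_inv {q M ε : ℝ} (hq1 : 1 < q) (hq2 : q ≤ 2) (hM : 1 < M) (hε : 0 < ε)
    (hεM : ε ≤ 1 / M) : (ε / M) ^ (1 / q) ≤ 1 / M := by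
  have hM0 : 0 < M := by linarith
  have hq0 : 0 < q := by linarith
  calc (ε / M) ^ (1 / q) ≤ ((1 / M) ^ 2) ^ (1 / q) := by
        refine Real.rpow_le_rpow (by positivity) ?_ (by positivity)
        calc ε / M ≤ 1 / M / M := by gcongr
          _ = (1 / M) ^ 2 := by ring
    _ = (1 / M) ^ (2 / q) := by
        rw [← Real.rpow_natCast, ← Real.rpow_mul (by positivity)]; congr 1; push_cast; ring
    _ ≤ (1 / M) ^ (1 : ℝ) :=
        Real.rpow_le_rpow_of_exponent_ge (by positivity) (by rw [div_le_one hM0]; exact hM.le)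
          (by rw [le_div_iff₀ hq0]; linarith)
    _ = 1 / M := Real.rpow_one _

theorem smoothing_error_le {q M ε μ : ℝ} (hq1 : 1 < q) (hM : 0 < M) (hε : 0 < ε) (hμ : 0 < μ)
    (hle : μ ≤ 1 / 2 * (ε / M) ^ (1 / q)) : μ ^ q * M ≤ ε / 2 := by
  have h1 : μ ^ q ≤ (1 / 2) ^ q * (ε / M) := by
    refine (Real.rpow_le_rpow hμ.le hle (by linarith)).trans_eq ?_
    rw [Real.mul_rpow (by norm_num) (by positivity), ← Real.rpow_mul (by positivity),
      one_div_mul_cancel (by linarith), Real.rpow_one]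
  have h2 : (1 / 2 : ℝ) ^ q ≤ 1 / 2 := by
    simpa using Real.rpow_le_rpow_of_exponent_ge (x := (1 / 2 : ℝ)) (by norm_num) (by norm_num)
      hq1.le
  calc μ ^ q * M ≤ 1 / 2 * (ε / M) * M := by
        refine mul_le_mul_of_nonneg_right (h1.trans ?_) hM.le
        gcongr
    _ = ε / 2 := by field_simp

/-- The exponent `q - 2` lies in `(-1, 0]`, so `c^(q-2) ≤ 1/c` uniformly in `q`; this keeps the
final constant dependent on `c` alone. -/
theorem rpow_smoothing_le {q M ε μ c : ℝ} (hq1 : 1 < q) (hq2 : q ≤ 2) (hM : 0 < M) (hε : 0 < ε)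
    (hc : 0 < c) (hc1 : c ≤ 1) (hle : c * (ε / M) ^ (1 / q) ≤ μ) :
    μ ^ (q - 2) ≤ 1 / c * (M / ε) ^ (2 / q - 1) := by
  have hs : 0 < ε / M := by positivity
  have hq0 : q ≠ 0 := by linarith
  calc μ ^ (q - 2) ≤ (c * (ε / M) ^ (1 / q)) ^ (q - 2) :=
        Real.rpow_le_rpow_of_nonpos (by positivity) hle (by linarith)
    _ = c ^ (q - 2) * (M / ε) ^ (2 / q - 1) := by
        rw [Real.mul_rpow hc.le (by positivity), ← Real.rpow_mul hs.le, ← inv_div M ε,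
          Real.inv_rpow (by positivity), ← Real.rpow_neg (by positivity)]
        congr 2
        field_simp
        ring
    _ ≤ c ^ (-1 : ℝ) * (M / ε) ^ (2 / q - 1) := by
        refine mul_le_mul_of_nonneg_right ?_ (by positivity)
        exact Real.rpow_le_rpow_of_exponent_ge hc hc1 (by linarith)
    _ = _ := by rw [Real.rpow_neg_one, one_div]

/-- The contraction reaches `ε²`, and the spare factor `ε` absorbs the initial gap; hence no
logarithm of that gap enters the iteration count. -/
theorem accuracy_of_iterations {ρ ε gap B : ℝ} {K : ℕ} (hρ : ρ ≤ 1) (hε : 0 < ε)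
    (hK : 2 * Real.log (1 / ε) ≤ ρ * K) (hgap : 0 ≤ gap) (hgapB : gap ≤ B / 2)
    (hεB : ε ≤ 1 / (|B| + 1)) : (1 - ρ) ^ K * gap ≤ ε / 2 := by
  have hB : 0 < |B| + 1 := by positivity
  have h1 : (1 - ρ) ^ K ≤ ε ^ 2 := by
    calc (1 - ρ) ^ K ≤ Real.exp (-ρ) ^ K :=
          pow_le_pow_left₀ (by linarith) (Real.one_sub_le_exp_neg ρ) K
      _ = Real.exp (-(ρ * K)) := by rw [← Real.exp_nat_mul]; congr 1; ring
      _ ≤ Real.exp (-(2 * Real.log (1 / ε))) := by gcongr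
      _ = ε ^ 2 := by
          rw [one_div, Real.log_inv, mul_neg, neg_neg, two_mul, Real.exp_add, Real.exp_log hε, sq]
  rw [le_div_iff₀ hB] at hεB
  calc (1 - ρ) ^ K * gap ≤ ε ^ 2 * (B / 2) := mul_le_mul h1 hgapB hgap (sq_nonneg ε)
    _ = ε / 2 * (ε * B) := by ring
    _ ≤ ε / 2 * 1 := by
        refine mul_le_mul_of_nonneg_left ?_ (by positivity)
        nlinarith [le_abs_self B]
    _ = ε / 2 := mul_one _

/-- Every term is a multiple of `M d a L`, all four factors being at least `1`: `162 = 7 + 2 + 2 ·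
51 + 51`, the last from rounding up `K`. -/
theorem total_time_le {M d a L n K : ℝ} (hM : 1 ≤ M) (hd : 1 ≤ d) (ha : 1 ≤ a) (hL : 1 ≤ L)
    (hn : n ≤ M) (hK : K ≤ 2 * (M * a * L) + 1) :
    7 * n + 2 + K * (51 * d) ≤ 162 * (M * d * a * L) := by
  have h1 : 1 ≤ d * a := one_le_mul_of_one_le_of_one_le hd ha
  have h2 : M ≤ M * d * a * L := by
    rw [mul_assoc M d a, mul_assoc]
    exact le_mul_of_one_le_right (by linarith) (one_le_mul_of_one_le_of_one_le h1 hL)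
  have h3 : d ≤ M * d * a * L := by
    rw [show M * d * a * L = d * (M * (a * L)) by ring]
    exact le_mul_of_one_le_right (by linarith)
      (one_le_mul_of_one_le_of_one_le hM (one_le_mul_of_one_le_of_one_le ha hL))
  have h4 : K * (51 * d) ≤ (2 * (M * a * L) + 1) * (51 * d) :=
    mul_le_mul_of_nonneg_right hK (by linarith)
  linarith

theorem Instance.exists_iterations {V : Type} [Fintype V] [DecidableEq V] {G : SimpleGraph V}
    [DecidableRel G.Adj] {p q μ : ℝ} {Δ xs : V → ℝ} (I : Instance G p q μ Δ xs)
    (hsupp : ((supp Δ).card : ℝ) ≤ mass Δ) {c ε γ : ℝ} (hc : 0 < c) (hc1 : c ≤ 1) (hε : 0 < ε)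
    (hεe : ε ≤ Real.exp (-1)) (hεB : ε ≤ 1 / (|(p - 1) * mass Δ ^ (p + 2)| + 1))
    (hμc : c * (ε / mass Δ) ^ (1 / q) ≤ μ) (hμ2 : μ ≤ 1 / 2 * (ε / mass Δ) ^ (1 / q))
    (hγ : 0 < γ) (hsc : StronglyConvex G q μ Δ p xs γ) :
    ∃ K : ℕ,
      (∀ y : V → ℝ, 0 ≤ y → expect (iterate G q μ Δ K) (F G q Δ) ≤ F G q Δ y + ε) ∧
      ∀ r ∈ (run G q μ Δ K).support,
        (r.time : ℝ) ≤ 162 / c * (mass Δ * (maxDegree G xs : ℝ) ^ 2 / γ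
          * (mass Δ / ε) ^ (2 / q - 1) * Real.log (1 / ε)) := by
  have hM := I.one_lt_mass
  have hM0 : 0 < mass Δ := by linarith
  have hd : (1 : ℝ) ≤ maxDegree G xs := Nat.one_le_cast.mpr I.one_le_maxDegree
  have hd0 : (0 : ℝ) < maxDegree G xs := I.maxDegree_pos
  have hμq : 0 < μ ^ (q - 2) := Real.rpow_pos_of_pos I.μ_pos _
  have hL : 1 ≤ Real.log (1 / ε) := by
    rw [one_div, Real.log_inv]
    have := Real.log_le_log hε hεe
    rw [Real.log_exp] at this
    linarith
  set L := Real.log (1 / ε)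
  set d : ℝ := (maxDegree G xs : ℝ) with hd_def
  set a := d * μ ^ (q - 2) / γ with ha_def
  have ha : 1 ≤ a := (one_le_div hγ).mpr (I.parameter_le hsc)
  set ρ := γ * μ ^ (2 - q) / (mass Δ * d) with hρ_def
  have hρ : ρ * (mass Δ * a) = 1 := by
    have hinv : μ ^ (q - 2) * μ ^ (2 - q) = 1 := by
      rw [← Real.rpow_add I.μ_pos]; simp
    rw [hρ_def, ha_def]
    field_simp
    linear_combination hinv
  have hρ0 : 0 ≤ ρ := by
    have := Real.rpow_nonneg I.μ_pos.le (2 - q)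
    positivity
  -- The contraction rate is `ρ = 1 / (|Δ| a)`, so this count gives `ρ K ≥ 2 L`.
  refine ⟨⌈2 * (mass Δ * a * L)⌉₊, ?_, ?_⟩
  · intro y hy
    have hK : 2 * L ≤ ρ * (⌈2 * (mass Δ * a * L)⌉₊ : ℝ) := by
      calc 2 * L = ρ * (2 * (mass Δ * a * L)) := by linear_combination (-2 * L) * hρ
        _ ≤ _ := mul_le_mul_of_nonneg_left (Nat.le_ceil _) hρ0
    have h1 := I.expect_objective_le hγ hsc ⌈2 * (mass Δ * a * L)⌉₊ hy
    have h2 := accuracy_of_iterations (I.rate_le_one hsc) hε hK (I.gap_nonneg I.below_zero)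
      I.initial_gap_le hεB
    have h3 := smoothing_error_le I.one_lt_q hM0 hε I.μ_pos hμ2
    linarith
  · intro r hr
    have h1 : (r.time : ℝ) ≤ 7 * (supp Δ).card + 2
        + (⌈2 * (mass Δ * a * L)⌉₊ : ℝ) * (51 * d) := by
      rw [hd_def]
      exact_mod_cast I.run_time_le _ r hr
    have h2 := total_time_le hM.le hd ha hL hsupp
      (Nat.ceil_lt_add_one (a := 2 * (mass Δ * a * L)) (by positivity)).le
    have h3 := rpow_smoothing_le I.one_lt_q I.q_le_two hM0 hε hc hc1 hμc
    calc (r.time : ℝ) ≤ 162 * (mass Δ * d * a * L) := h1.trans h2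
      _ = 162 * (mass Δ * d ^ 2 / γ * μ ^ (q - 2) * L) := by rw [ha_def]; ring
      _ ≤ 162 * (mass Δ * d ^ 2 / γ * (1 / c * (mass Δ / ε) ^ (2 / q - 1)) * L) := by gcongr
      _ = _ := by ring

end FlowDiffusion

theorem mainTheorem4 :
    ∃ c₀ : ℝ, 0 < c₀ ∧ ∀ c : ℝ, 0 < c → c ≤ c₀ →
    ∃ C : ℝ, 0 < C ∧
    ∀ p q : ℝ, p.HolderConjugate q → q ≤ 2 →
    ∀ M : ℝ, ∃ ε₀ : ℝ, 0 < ε₀ ∧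
    ∀ (V : Type) [Fintype V] [DecidableEq V] (G : SimpleGraph V) [DecidableRel G.Adj]
      (Δ : V → ℝ),
      G.Connected → 0 ≤ Δ → mass Δ = M → mass Δ < volume G →
      ((supp Δ).card : ℝ) ≤ mass Δ → (∃ v, (G.degree v : ℝ) < Δ v) →
    ∀ ε : ℝ, 0 < ε → ε ≤ ε₀ →
    ∀ μ : ℝ, c * (ε / mass Δ) ^ (1 / q) ≤ μ → μ ≤ c₀ * (ε / mass Δ) ^ (1 / q) →
      -- the program executes the coordinate method
      (∀ k, (run G q μ Δ k).map (fun r => r.val.height) = iterate G q μ Δ k) ∧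
      ∀ xs : V → ℝ, IsSmoothedOptimum G q μ Δ xs →
        -- the quantities in the time bound are controlled by `p` and `|Δ|` alone
        (maxDegree G xs : ℝ) ≤ mass Δ ∧
        (∃ γ : ℝ, 1 / ((p - 1) * mass Δ ^ p) < γ ∧ StronglyConvex G q μ Δ p xs γ) ∧
        -- accuracy and running time
        ∀ γ : ℝ, 0 < γ → StronglyConvex G q μ Δ p xs γ →
          ∃ K : ℕ,
            (∀ y : V → ℝ, 0 ≤ y → expect (iterate G q μ Δ K) (F G q Δ) ≤ F G q Δ y + ε) ∧
            ∀ r ∈ (run G q μ Δ K).support,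
              (r.time : ℝ) ≤
                C * (mass Δ * (maxDegree G xs : ℝ) ^ 2 / γ
                  * (mass Δ / ε) ^ (2 / q - 1) * Real.log (1 / ε)) := by
  -- The factor `1/2` makes the smoothing error at most `ε/2`. The three bounds on `ε` give `log
  -- (1/ε) ≥ 1`, absorb the initial gap, and ensure `μ ≤ 1/|Δ|`; absolute values keep them positive
  -- for arbitrary real `M`.
  refine ⟨1 / 2, by norm_num, fun c hc hc2 => ⟨162 / c, by positivity,
    fun p q hpq hq2 M => ⟨min (Real.exp (-1)) (min (1 / (|(p - 1) * M ^ (p + 2)| + 1))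
      (1 / (|M| + 1))), by positivity, ?_⟩⟩⟩
  intro V _ _ G _ Δ hG hΔ hMΔ hvol hsupp hex ε hε hε0 μ hμ1 hμ2
  subst hMΔ
  rw [le_min_iff, le_min_iff] at hε0
  obtain ⟨hεe, hεB, hεM⟩ := hε0
  have hM := one_lt_mass hG hΔ hvol hex
  have hM0 : 0 < mass Δ := by linarith
  have hq1 : 1 < q := hpq.symm.lt
  have hμ : 0 < μ := lt_of_lt_of_le (by positivity) hμ1
  have hεM' : ε ≤ 1 / mass Δ :=
    hεM.trans (one_div_le_one_div_of_le hM0 (by linarith [le_abs_self (mass Δ)]))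
  have hμM : μ ≤ 1 / mass Δ := by
    have h1 := scale_le_inv hq1 hq2 hM hε hεM'
    have h2 : 0 ≤ (ε / mass Δ) ^ (1 / q) := by positivity
    linarith
  refine ⟨run_map_height hμ (by linarith), fun xs hxs => ?_⟩
  have I : Instance G p q μ Δ xs := ⟨hpq, hq2, hμ, hμM, hG, hΔ, hvol, hex, hxs⟩
  exact ⟨I.maxDegree_le_mass, I.exists_stronglyConvex, fun γ hγ hsc =>
    I.exists_iterations hsupp hc (by linarith) hε hεe hεB hμ1 hμ2 hγ hsc⟩
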